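/- Conventions. An affine variety is a Zariski closed subset of some $\mathbb{C}^n$, not necessarily irreducible. A parametric curve of degree at most $d$ in $\mathbb{C}^n$ is the image of $\mathbb{C}$ under a nonconstant polynomial map $t\mapsto(\varphi_1(t),\dots,\varphi_n(t))$ with $\deg\varphi_i\le d$ for all $i$. An affine variety $V$ has degree of $\mathbb{C}$-uniruledness at most $d$ if for every irreducible component $Z$ of $V$ and every point $x\in Z$ there is a parametric curve of degree at most $d$ that is contained in $Z$ and passes through $x$. Let $X\subset\mathbb{C}^n$ be an affine variety and let $f=(f_1,\dots,f_m)\colon X\to\mathbb{C}^m$ be the restriction to $X$ of a polynomial map; we say that it has degree at most $d_2$ if the $f_i$ can be chosen to be restrictions of polynomials of total degree at most $d_2$. The map $f$ is generically finite if there is a Zariski open and dense subset $U\subset X$ such that $f|_U$ has finite fibres. The map $f$ is proper at a point $y\in\overline{f(X)}$ (Zariski closure) if $y$ has an affine Zariski open neighbourhood $U\subset\overline{f(X)}$ such that $f^{-1}(U)$ is affine and $f|_{f^{-1}(U)}\colon f^{-1}(U)\to U$ is finite, i.e. $\mathbb{C}[f^{-1}(U)]$ is integral over $\mathbb{C}[U]$.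 Let $S_f$ be the set of all points $y\in\overline{f(X)}$ at which $f$ is not proper. Theorem. Let $X\subset\mathbb{C}^n$ be an affine variety with degree of $\mathbb{C}$-uniruledness at most $d_1$, and let $f\colon X\to\mathbb{C}^m$ be a generically finite polynomial map of degree at most $d_2$. Then either $S_f$ is empty, or $S_f$ is an affine variety with degree of $\mathbb{C}$-uniruledness at most $d_1d_2$. -/

import Mathlib

open AlgebraicGeometry CategoryTheory

noncomputable section

namespace AffineUniruled

/-- A subset of `ℂⁿ` is an affine variety (not necessarily irreducible) if it is the common zero
set of a family of polynomials. -/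
def IsAffineVariety {n : ℕ} (V : Set (Fin n → ℂ)) : Prop :=
  ∃ I : Ideal (MvPolynomial (Fin n) ℂ), V = MvPolynomial.zeroLocus ℂ I

/-- The Zariski closure of a subset of `ℂⁿ`. -/
def zariskiClosure {n : ℕ} (S : Set (Fin n → ℂ)) : Set (Fin n → ℂ) :=
  MvPolynomial.zeroLocus ℂ (MvPolynomial.vanishingIdeal ℂ S)

/-- An irreducible affine variety: nonempty, and not the union of two proper closed subsets. -/
def IsIrreducibleVariety {n : ℕ} (V : Set (Fin n → ℂ)) : Prop :=
  IsAffineVariety V ∧ V.Nonempty ∧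
    ∀ A B : Set (Fin n → ℂ), IsAffineVariety A → IsAffineVariety B → V ⊆ A ∪ B →
      V ⊆ A ∨ V ⊆ B

/-- `Z` is an irreducible component of `V`: a maximal irreducible subvariety of `V`. -/
def IsIrreducibleComponent {n : ℕ} (Z V : Set (Fin n → ℂ)) : Prop :=
  Maximal (fun A => IsIrreducibleVariety A ∧ A ⊆ V) Z

/-- `Γ ⊆ ℂⁿ` is a parametric curve of degree at most `d`: the image of `ℂ` under a nonconstant
polynomial map `t ↦ (φ₁(t), …, φₙ(t))` with `deg φᵢ ≤ d` for all `i`. (Such an image is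
automatically a Zariski closed irreducible curve.) -/
def IsParametricCurve {n : ℕ} (d : ℕ) (Γ : Set (Fin n → ℂ)) : Prop :=
  ∃ φ : Fin n → Polynomial ℂ,
    (∀ i, (φ i).natDegree ≤ d) ∧ (∃ i, 0 < (φ i).natDegree) ∧
      Γ = Set.range fun t : ℂ => fun i => (φ i).eval t

/-- `V` is an affine variety with degree of `ℂ`-uniruledness at most `d`: through every point of
every irreducible component `Z` of `V` passes a parametric curve of degree at most `d` which is
contained in `Z`. -/
def HasUniruledDegreeAtMost {n : ℕ} (d : ℕ) (V : Set (Fin n → ℂ)) : Prop :=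
  IsAffineVariety V ∧
    ∀ Z, IsIrreducibleComponent Z V → ∀ x ∈ Z,
      ∃ Γ : Set (Fin n → ℂ), IsParametricCurve d Γ ∧ Γ ⊆ Z ∧ x ∈ Γ

/-- The polynomial map `ℂⁿ → ℂᵐ` with components `F₁, …, Fₘ`. -/
def polyMap {n m : ℕ} (F : Fin m → MvPolynomial (Fin n) ℂ) (x : Fin n → ℂ) : Fin m → ℂ :=
  fun i => MvPolynomial.eval x (F i)

/-- The restriction of `F` to the affine variety `X` is generically finite: it has finite fibres
on some Zariski open and Zariski dense subset `X \ A` of `X`. -/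
def GenericallyFiniteOn {n m : ℕ} (F : Fin m → MvPolynomial (Fin n) ℂ)
    (X : Set (Fin n → ℂ)) : Prop :=
  ∃ A : Set (Fin n → ℂ), IsAffineVariety A ∧ X ⊆ zariskiClosure (X \ A) ∧
    ∀ y : Fin m → ℂ, {x | x ∈ X \ A ∧ polyMap F x = y}.Finite

/-- The coordinate ring `ℂ[V]`. -/
abbrev CoordRing {n : ℕ} (V : Set (Fin n → ℂ)) : Type :=
  MvPolynomial (Fin n) ℂ ⧸ MvPolynomial.vanishingIdeal ℂ V

/-- Evaluation of the elements of `ℂ[V]` at a point of `V`. -/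
def evalAt {n : ℕ} (V : Set (Fin n → ℂ)) (v : V) : CoordRing V →+* ℂ :=
  Ideal.Quotient.lift (MvPolynomial.vanishingIdeal ℂ V) (MvPolynomial.eval (v : Fin n → ℂ))
    fun p hp => by
      simpa [MvPolynomial.aeval_eq_eval] using
        (MvPolynomial.mem_vanishingIdeal_iff.mp hp) v v.2

/-- The affine variety `V` as a scheme. -/
abbrev toScheme {n : ℕ} (V : Set (Fin n → ℂ)) : Scheme :=
  Spec (CommRingCat.of (CoordRing V))

/-- The closed point of the scheme attached to `V` that corresponds to a point of `V`. -/
def toPoint {n : ℕ} (V : Set (Fin n → ℂ)) (v : V) : toScheme V :=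
  (⟨RingHom.ker (evalAt V v), RingHom.ker_isPrime (evalAt V v)⟩ : PrimeSpectrum (CoordRing V))

/-- The closure of the image of `X` under the polynomial map `F`. -/
abbrev closureImage {n m : ℕ} (F : Fin m → MvPolynomial (Fin n) ℂ) (X : Set (Fin n → ℂ)) :
    Set (Fin m → ℂ) :=
  zariskiClosure (polyMap F '' X)

theorem vanishingIdeal_le_comap {n m : ℕ} (F : Fin m → MvPolynomial (Fin n) ℂ)
    (X : Set (Fin n → ℂ)) :
    MvPolynomial.vanishingIdeal ℂ (closureImage F X) ≤
      (MvPolynomial.vanishingIdeal ℂ X).comap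
        (MvPolynomial.bind₁ F : MvPolynomial (Fin m) ℂ →ₐ[ℂ] MvPolynomial (Fin n) ℂ).toRingHom := by
  intro p hp
  refine MvPolynomial.mem_vanishingIdeal_iff.mpr fun x hx => ?_
  have h := MvPolynomial.mem_vanishingIdeal_iff.mp hp (polyMap F x)
    (MvPolynomial.zeroLocus_vanishingIdeal_le _ ⟨x, hx, rfl⟩)
  simp only [AlgHom.toRingHom_eq_coe, RingHom.coe_coe, MvPolynomial.aeval_bind₁]
  exact h

/-- The homomorphism `h ↦ h ∘ F` from the coordinate ring of the closure of `F(X)` to that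
of `X`. -/
def pullback {n m : ℕ} (F : Fin m → MvPolynomial (Fin n) ℂ) (X : Set (Fin n → ℂ)) :
    CoordRing (closureImage F X) →+* CoordRing X :=
  Ideal.quotientMap (MvPolynomial.vanishingIdeal ℂ X)
    (MvPolynomial.bind₁ F : MvPolynomial (Fin m) ℂ →ₐ[ℂ] MvPolynomial (Fin n) ℂ).toRingHom
    (vanishingIdeal_le_comap F X)

/-- The restriction of `F` to `X`, as a (dominant) morphism of schemes from `X` to the closure of
`F(X)`. -/
def toMorphism {n m : ℕ} (F : Fin m → MvPolynomial (Fin n) ℂ) (X : Set (Fin n → ℂ)) :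
    toScheme X ⟶ toScheme (closureImage F X) :=
  Spec.map (CommRingCat.ofHom (pullback F X))

/-- `F|_X` is proper at the point `y` of the closure of `F(X)`: there is an affine Zariski open
neighbourhood `U` of `y` such that `F|_X⁻¹(U)` is affine and `F|_X⁻¹(U) ⟶ U` is finite. (The
preimages being affine is part of `IsFinite`.) -/
def IsProperAtPoint {n m : ℕ} (F : Fin m → MvPolynomial (Fin n) ℂ) (X : Set (Fin n → ℂ))
    (y : closureImage F X) : Prop :=
  ∃ U : (toScheme (closureImage F X)).Opens,
    IsAffineOpen U ∧ toPoint (closureImage F X) y ∈ U ∧ IsFinite (toMorphism F X ∣_ U)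

/-- The set `S_f`, `f = F|_X`, of points of the closure of `f(X)` at which `f` is not proper. -/
def nonProperSet {n m : ℕ} (F : Fin m → MvPolynomial (Fin n) ℂ) (X : Set (Fin n → ℂ)) :
    Set (Fin m → ℂ) :=
  {y | ∃ hy : y ∈ closureImage F X, ¬ IsProperAtPoint F X ⟨y, hy⟩}

end AffineUniruled

end

/-!
The values of `F` approached along points of `X` tending to infinity are exactly the points of the
non-properness set, and these can be moved along curves. If `x` runs through points of `X` tending
to infinity such that `F x` tends to `y`, choose a parametric curve of degree at most `d₁` in `X`
through each `x`. Its image under `F` is a parametric curve of degree at most `d₁ * d₂` through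
`F x`, not constant if `x` is chosen in the open set where `F` has finite fibres. Reparametrized to
have coefficients of norm one, the images accumulate at a nonconstant curve through `y`
(`exists_tendsto_curve`). The curves in `X` also tend to infinity, for all but finitely many
parameters (`exists_finite_forall_tendsto_norm_curve`), so the limit curve lies in the
non-properness set, which is Zariski closed. This is `exists_curve_subset_nonProperSet`. Another
passage to the limit puts the curve into a given component
(`hasUniruledDegreeAtMost_of_forall_exists_curve`). Limits are taken along ultrafilters, which
replaces the choice of subsequences.

Two facts link the Euclidean limits to the algebraic definitions.

* The image of an affine variety under a polynomial map has the same closure in the Zariski and in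
  the Euclidean topology (`mem_closure_image_of_mem_zeroLocus`). By Chevalley's theorem it is enough
  to know that the complement of a hypersurface is Euclidean dense in an irreducible variety, which
  follows from Noether normalization and the continuity of roots
  (`mem_closure_setOf_algHom_ne_zero`).
* `F` is proper at `y` if and only if every coordinate `xᵢ` on `X`, multiplied by a function which
  does not vanish at `y`, is integral over the functions on the closure of the image
  (`isProperAtPoint_iff_forall_coordinate`). If this holds, the coordinates are bounded over a
  neighbourhood of `y`. If it fails for `xᵢ`, then `(y, 0)` is in the Zariski closure of the image
  of `x ↦ (F x, 1 / xᵢ)`, hence in its Euclidean closure, so `y` is approached at infinity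
  (`exists_tendsto_of_mem_nonProperSet`).
-/

namespace AffineUniruled

open Filter Topology

/-! ### Points of finitely generated algebras -/

theorem algHom_eq_of_ker_le {B : Type*} [CommRing B] [Algebra ℂ B] {p q : B →ₐ[ℂ] ℂ}
    (h : RingHom.ker p ≤ RingHom.ker q) : p = q := by
  ext x
  have hx : x - algebraMap ℂ B (p x) ∈ RingHom.ker q := h (by simp [RingHom.mem_ker])
  rw [RingHom.mem_ker, map_sub, AlgHom.commutes, sub_eq_zero] at hx
  exact hx.symm

theorem ker_algHom_isMaximal {B : Type*} [CommRing B] [Algebra ℂ B] (q : B →ₐ[ℂ] ℂ) :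
    (RingHom.ker q).IsMaximal :=
  RingHom.ker_isMaximal_of_surjective q fun z => ⟨algebraMap ℂ B z, by simp⟩

theorem exists_algHom_ker_eq {R : Type*} [CommRing R] [Algebra ℂ R] [Algebra.FiniteType ℂ R]
    (M : Ideal R) [M.IsMaximal] : ∃ q : R →ₐ[ℂ] ℂ, RingHom.ker q = M := by
  let _ : Field (R ⧸ M) := Ideal.Quotient.field M
  have : Module.Finite ℂ (R ⧸ M) := finite_of_finite_type_of_isJacobsonRing ℂ (R ⧸ M)
  let ψ : (R ⧸ M) →ₐ[ℂ] ℂ := IsAlgClosed.lift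
  refine ⟨ψ.comp (Ideal.Quotient.mkₐ ℂ M), ?_⟩
  ext x
  simp [RingHom.mem_ker, Ideal.Quotient.eq_zero_iff_mem]

/-- A point of `B` lifts along `φ : B → R` as soon as some prime ideal of `R` lies over it: any
maximal ideal containing that prime lies over it as well. -/
theorem exists_algHom_comp_eq_of_comap_eq {B R : Type*} [CommRing B] [CommRing R] [Algebra ℂ B]
    [Algebra ℂ R] [Algebra.FiniteType ℂ R] (φ : B →ₐ[ℂ] R) (p : B →ₐ[ℂ] ℂ) (Q : Ideal R)
    [Q.IsPrime] (hQ : Q.comap φ = RingHom.ker p) : ∃ q : R →ₐ[ℂ] ℂ, q.comp φ = p := by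
  obtain ⟨M, hM, hQM⟩ := Q.exists_le_maximal Ideal.IsPrime.ne_top'
  obtain ⟨q, hq⟩ := exists_algHom_ker_eq M
  refine ⟨q, (algHom_eq_of_ker_le fun x hx => ?_).symm⟩
  have h : φ x ∈ Q := by rwa [← hQ] at hx
  have : φ x ∈ RingHom.ker q := hq ▸ hQM h
  simpa [RingHom.mem_ker] using this

theorem exists_algHom_comp_eq_of_isIntegral {B R : Type*} [CommRing B] [CommRing R] [Algebra ℂ B]
    [Algebra ℂ R] [Algebra.FiniteType ℂ R] (φ : B →ₐ[ℂ] R) (hφ : φ.toRingHom.IsIntegral)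
    (p : B →ₐ[ℂ] ℂ) (hp : RingHom.ker φ ≤ RingHom.ker p) :
    ∃ q : R →ₐ[ℂ] ℂ, q.comp φ = p := by
  let _ : Algebra B R := φ.toRingHom.toAlgebra
  have : Algebra.IsIntegral B R := ⟨hφ⟩
  have := ker_algHom_isMaximal p
  obtain ⟨Q, hQ, hQp⟩ := Ideal.exists_ideal_over_maximal_of_isIntegral (S := R) (RingHom.ker p) hp
  have := hQ.isPrime
  exact exists_algHom_comp_eq_of_comap_eq φ p Q hQp

/-- If `B ⊆ R` are domains of finite type, the points of `B` outside some hypersurface lift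
to `R`. By Chevalley's theorem the image of `Spec R` is constructible; as it contains the generic
point, it contains a basic open set. -/
theorem exists_ne_zero_forall_exists_algHom_comp_eq {B R : Type*} [CommRing B] [CommRing R]
    [IsDomain B] [IsDomain R] [Algebra ℂ B] [Algebra ℂ R] [Algebra.FiniteType ℂ B]
    [Algebra.FiniteType ℂ R] (φ : B →ₐ[ℂ] R) (hφ : Function.Injective φ) :
    ∃ b : B, b ≠ 0 ∧ ∀ p : B →ₐ[ℂ] ℂ, p b ≠ 0 → ∃ q : R →ₐ[ℂ] ℂ, q.comp φ = p := by
  have : IsNoetherianRing B := Algebra.FiniteType.isNoetherianRing ℂ B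
  have hfp : φ.toRingHom.FinitePresentation := by
    rw [← RingHom.FinitePresentation.of_finiteType]
    refine RingHom.FiniteType.of_comp_finiteType (f := algebraMap ℂ B) ?_
    rw [show φ.toRingHom.comp (algebraMap ℂ B) = algebraMap ℂ R from φ.comp_algebraMap]
    exact RingHom.finiteType_algebraMap.mpr inferInstance
  obtain ⟨S, hS⟩ := PrimeSpectrum.exists_constructibleSetData_iff.mpr
    (PrimeSpectrum.isConstructible_range_comap hfp)
  have h0 : (⊥ : PrimeSpectrum B) ∈ S.toSet := by
    rw [hS]
    refine ⟨⊥, PrimeSpectrum.ext ?_⟩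
    exact Ideal.comap_bot_of_injective φ.toRingHom hφ
  simp only [PrimeSpectrum.ConstructibleSetData.toSet, Set.mem_iUnion] at h0
  obtain ⟨c, hc, hg, hf⟩ := h0
  have hg0 : ∀ i, c.g i = 0 := fun i => by
    have := hg ⟨i, rfl⟩
    simpa using this
  refine ⟨c.f, fun h => hf (by simp [h]), fun p hp => ?_⟩
  have hmem : (⟨RingHom.ker p, (ker_algHom_isMaximal p).isPrime⟩ : PrimeSpectrum B) ∈ S.toSet := by
    simp only [PrimeSpectrum.ConstructibleSetData.toSet, Set.mem_iUnion]
    refine ⟨c, hc, ?_, ?_⟩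
    · rintro _ ⟨i, rfl⟩
      simp [hg0 i]
    · simpa [PrimeSpectrum.mem_zeroLocus, RingHom.mem_ker] using hp
  rw [hS] at hmem
  obtain ⟨Q, hQ⟩ := hmem
  exact exists_algHom_comp_eq_of_comap_eq φ p Q.asIdeal (congrArg PrimeSpectrum.asIdeal hQ)

/-- Over an integrally closed base `A` the points of an integral extension domain `B` lying over a
given point of `A` realise every root of the specialised minimal polynomial of `h ∈ B`. -/
theorem exists_algHom_of_eval_minpoly_eq_zero {A B : Type*} [CommRing A] [CommRing B] [IsDomain A]
    [IsIntegrallyClosed A] [IsDomain B] [Algebra ℂ A] [Algebra ℂ B] [Algebra A B]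
    [IsScalarTower ℂ A B] [FaithfulSMul A B] [Algebra.IsIntegral A B] [Algebra.FiniteType ℂ B]
    (h : B) (t : A →ₐ[ℂ] ℂ) (s : ℂ) (hs : (minpoly A h).eval₂ t.toRingHom s = 0) :
    ∃ q : B →ₐ[ℂ] ℂ, (∀ a, q (algebraMap A B a) = t a) ∧ q h = s := by
  let φ : Polynomial A →ₐ[ℂ] B := (Polynomial.aeval (R := A) h).restrictScalars ℂ
  let p : Polynomial A →ₐ[ℂ] ℂ :=
    { Polynomial.eval₂RingHom t.toRingHom s with
      commutes' := fun z => by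
        simp [Polynomial.algebraMap_apply] }
  have hp : ∀ P, p P = P.eval₂ t.toRingHom s := fun _ => rfl
  obtain ⟨q, hq⟩ := exists_algHom_comp_eq_of_isIntegral φ
    (fun b => by
      obtain ⟨P, hP, hb⟩ := Algebra.IsIntegral.isIntegral (R := A) b
      refine ⟨P.map Polynomial.C, hP.map _, ?_⟩
      rw [Polynomial.eval₂_map, ← hb]
      congr 1
      ext a
      simp [φ]) p (fun P hP => by
        have hP : Polynomial.aeval h P = 0 := hP
        obtain ⟨G, rfl⟩ := minpoly.isIntegrallyClosed_dvd (Algebra.IsIntegral.isIntegral h) hP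
        rw [RingHom.mem_ker, hp, Polynomial.eval₂_mul, hs, zero_mul])
  refine ⟨q, fun a => ?_, ?_⟩
  · have := DFunLike.congr_fun hq (Polynomial.C a)
    simpa [φ, hp] using this
  · have := DFunLike.congr_fun hq Polynomial.X
    simpa [φ, hp] using this

/-! ### Roots of polynomials with converging coefficients -/

theorem tendsto_eval₂_of_tendsto {ι A : Type*} [CommRing A] {l : Filter ι} {e : ι → A →+* ℂ}
    {e₀ : A →+* ℂ} (he : ∀ a, Tendsto (fun i => e i a) l (𝓝 (e₀ a))) (P : Polynomial A) (s : ℂ) :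
    Tendsto (fun i => P.eval₂ (e i) s) l (𝓝 (P.eval₂ e₀ s)) := by
  simp only [Polynomial.eval₂_eq_sum_range]
  exact tendsto_finsetSum _ fun j _ => (he _).mul_const _

/-- Roots stay bounded as long as the leading coefficient does not tend to zero. -/
theorem eventually_norm_le_of_eval₂_eq_zero {ι A : Type*} [CommRing A] {l : Filter ι}
    {e : ι → A →+* ℂ} {e₀ : A →+* ℂ} (he : ∀ a, Tendsto (fun i => e i a) l (𝓝 (e₀ a)))
    {P : Polynomial A} (hP : e₀ P.leadingCoeff ≠ 0) {v : ι → ℂ}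
    (hv : ∀ᶠ i in l, P.eval₂ (e i) (v i) = 0) : ∃ C, ∀ᶠ i in l, ‖v i‖ ≤ C := by
  set r := P.natDegree
  have hpos : 0 < ‖e₀ P.leadingCoeff‖ := norm_pos_iff.mpr hP
  set C := ∑ j ∈ Finset.range r, (‖e₀ (P.coeff j)‖ + 1)
  have hlead : ∀ᶠ i in l, ‖e₀ P.leadingCoeff‖ / 2 < ‖e i P.leadingCoeff‖ :=
    (he _).norm.eventually_const_lt (by linarith)
  have hcoef : ∀ᶠ i in l, ∀ j ∈ Finset.range r, ‖e i (P.coeff j)‖ < ‖e₀ (P.coeff j)‖ + 1 :=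
    (Finset.eventually_all _).mpr fun j _ => (he _).norm.eventually_lt_const (by linarith)
  refine ⟨max 1 (C / (‖e₀ P.leadingCoeff‖ / 2)), ?_⟩
  filter_upwards [hlead, hcoef, hv] with i h1 h2 h3
  by_contra! hlt
  obtain ⟨hv1, hvC⟩ := max_lt_iff.mp hlt
  rw [Polynomial.eval₂_eq_sum_range, Finset.sum_range_succ, add_comm, add_eq_zero_iff_eq_neg] at h3
  have h4 : ‖e i P.leadingCoeff‖ * ‖v i‖ ^ r ≤
      ∑ j ∈ Finset.range r, (‖e₀ (P.coeff j)‖ + 1) * ‖v i‖ ^ j := by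
    calc ‖e i P.leadingCoeff‖ * ‖v i‖ ^ r
        = ‖∑ j ∈ Finset.range r, e i (P.coeff j) * v i ^ j‖ := by
          rw [← norm_pow, ← norm_mul]
          exact (congrArg norm h3).trans (norm_neg _)
      _ ≤ ∑ j ∈ Finset.range r, ‖e i (P.coeff j) * v i ^ j‖ := norm_sum_le _ _
      _ ≤ _ := Finset.sum_le_sum fun j hj => by
          rw [norm_mul, norm_pow]
          exact mul_le_mul_of_nonneg_right (h2 j hj).le (by positivity)
  rw [div_lt_iff₀ (by positivity)] at hvC
  obtain hr | ⟨k, hk⟩ : r = 0 ∨ ∃ k, r = k + 1 := by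
    cases hr : r with
    | zero => exact Or.inl rfl
    | succ k => exact Or.inr ⟨k, rfl⟩
  · rw [hr] at h4
    simp only [pow_zero, mul_one, Finset.range_zero, Finset.sum_empty] at h4
    linarith
  · have h5 : ∑ j ∈ Finset.range r, (‖e₀ (P.coeff j)‖ + 1) * ‖v i‖ ^ j ≤ C * ‖v i‖ ^ k := by
      rw [Finset.sum_mul]
      refine Finset.sum_le_sum fun j hj => mul_le_mul_of_nonneg_left ?_ (by positivity)
      exact pow_le_pow_right₀ hv1.le (by have := Finset.mem_range.mp hj; omega)
    have h6 : ‖e i P.leadingCoeff‖ * ‖v i‖ ≤ C := by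
      have hk0 : 0 < ‖v i‖ ^ k := by positivity
      refine le_of_mul_le_mul_right ?_ hk0
      calc ‖e i P.leadingCoeff‖ * ‖v i‖ * ‖v i‖ ^ k = ‖e i P.leadingCoeff‖ * ‖v i‖ ^ r := by
            rw [hk]; ring
        _ ≤ _ := h4.trans h5
    nlinarith

theorem exists_root_norm_sub_pow_le {Q : Polynomial ℂ} (hQ : Q.Monic) (hd : Q.natDegree ≠ 0)
    (z : ℂ) : ∃ s, Q.eval s = 0 ∧ ‖z - s‖ ^ Q.natDegree ≤ ‖Q.eval z‖ := by
  have hsplit : Q.Splits := IsAlgClosed.splits Q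
  have hcard : Q.roots.card = Q.natDegree := hsplit.natDegree_eq_card_roots.symm
  have hne : Q.roots.toFinset.Nonempty := by
    obtain ⟨s, hs⟩ := Multiset.card_pos_iff_exists_mem.mp (by omega : 0 < Q.roots.card)
    exact ⟨s, by simpa using hs⟩
  obtain ⟨s, hs, hmin⟩ := Q.roots.toFinset.exists_min_image (fun s => ‖z - s‖) hne
  refine ⟨s, by simpa using (Polynomial.mem_roots'.mp (Multiset.mem_toFinset.mp hs)).2, ?_⟩
  have := Multiset.prod_map_le_prod_map₀ (s := Q.roots) (fun _ => ‖z - s‖) (fun b => ‖z - b‖)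
    (by intros; positivity) (fun b hb => hmin b (by simpa using hb))
  rw [Multiset.map_const', Multiset.prod_replicate, hcard] at this
  refine this.trans_eq ?_
  rw [hsplit.eval_eq_prod_roots_of_monic hQ]
  exact Multiset.prod_hom' Q.roots (normHom : ℂ →*₀ ℝ) fun x => z - x

/-- A root of the limit of monic polynomials is a limit of roots. -/
theorem exists_tendsto_of_eval₂_eq_zero {ι A : Type*} [CommRing A] {l : Filter ι}
    {e : ι → A →+* ℂ} {e₀ : A →+* ℂ} (he : ∀ a, Tendsto (fun i => e i a) l (𝓝 (e₀ a)))
    {P : Polynomial A} (hP : P.Monic) {s₀ : ℂ} (hs₀ : P.eval₂ e₀ s₀ = 0) :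
    ∃ s : ι → ℂ, (∀ i, P.eval₂ (e i) (s i) = 0) ∧ Tendsto s l (𝓝 s₀) := by
  have hd : P.natDegree ≠ 0 := fun h => by
    rw [hP.natDegree_eq_zero.mp h] at hs₀
    simp at hs₀
  have hdeg : ∀ i, (P.map (e i)).natDegree = P.natDegree := fun i => hP.natDegree_map _
  choose s hs hle using fun i =>
    exists_root_norm_sub_pow_le (hP.map (e i)) (by rwa [hdeg]) s₀
  refine ⟨s, fun i => by rw [← Polynomial.eval_map]; exact hs i, ?_⟩
  rw [Metric.tendsto_nhds]
  intro ε hε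
  have h0 : Tendsto (fun i => ‖P.eval₂ (e i) s₀‖) l (𝓝 0) := by
    simpa [hs₀] using (tendsto_eval₂_of_tendsto he P s₀).norm
  filter_upwards [h0.eventually_lt_const (pow_pos hε P.natDegree)] with i hi
  have := (hle i).trans_lt (by rwa [Polynomial.eval_map])
  rw [hdeg] at this
  rw [dist_comm, dist_eq_norm]
  exact lt_of_pow_lt_pow_left₀ _ hε.le this

theorem exists_tendsto_of_eventually_norm_le {ι E : Type*} [NormedAddCommGroup E] [ProperSpace E]
    (l : Ultrafilter ι) {v : ι → E} {C : ℝ} (h : ∀ᶠ i in l, ‖v i‖ ≤ C) :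
    ∃ x, Tendsto v l (𝓝 x) := by
  obtain ⟨x, -, hx⟩ := (isCompact_closedBall (0 : E) C).ultrafilter_le_nhds (l.map v)
    (by
      rw [le_principal_iff]
      exact h.mono fun i hi => by simpa using hi)
  exact ⟨x, hx⟩

/-! ### Zariski closures and Euclidean closures of images -/

theorem dense_setOf_aeval_ne_zero {σ : Type*} {c : MvPolynomial σ ℂ} (hc : c ≠ 0) :
    Dense {t : σ → ℂ | MvPolynomial.aeval t c ≠ 0} := by
  intro t₀
  obtain ⟨t₁, h₁⟩ : ∃ t₁ : σ → ℂ, MvPolynomial.aeval t₁ c ≠ 0 := by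
    by_contra! h
    exact hc (MvPolynomial.funext fun x => by simpa [MvPolynomial.aeval_eq_eval] using h x)
  -- restrict `c` to the line through `t₀` and `t₁`
  let γ : ℂ → σ → ℂ := fun s j => t₀ j + s * (t₁ j - t₀ j)
  let P : Polynomial ℂ := MvPolynomial.aeval
    (fun j => Polynomial.C (t₀ j) + Polynomial.X * Polynomial.C (t₁ j - t₀ j)) c
  have hP : ∀ s, P.eval s = MvPolynomial.aeval (γ s) c := fun s => by
    have : (Polynomial.aeval s).comp (MvPolynomial.aeval
        (fun j => Polynomial.C (t₀ j) + Polynomial.X * Polynomial.C (t₁ j - t₀ j))) =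
        MvPolynomial.aeval (γ s) := by
      ext j
      simp [γ]
    rw [← this, AlgHom.comp_apply, Polynomial.coe_aeval_eq_eval]
  have hP0 : P ≠ 0 := fun h => h₁ (by simpa [h, γ] using (hP 1).symm)
  have hdense : Dense {s : ℂ | P.eval s ≠ 0} := by
    have hfin : {s : ℂ | P.eval s = 0}.Finite := by
      simpa [Polynomial.IsRoot] using Polynomial.finite_setOfPred_isRoot hP0
    exact hfin.countable.dense_compl ℂ
  have hγ : Continuous γ := by fun_prop
  have h0 : γ 0 = t₀ := by simp [γ]
  rw [← h0]
  exact map_mem_closure hγ (hdense 0) fun s hs => by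
    simpa only [Set.mem_ofPred_eq, ← hP] using hs

/-- The points of an affine variety off a hypersurface are dense in the Euclidean topology.
Here the variety is given by a domain `B` with generators `π (X i)`. By Noether normalization `B`
is integral over a polynomial ring, points of which can be moved off the hypersurface. A generic
linear form `h` separates `p` from the other points of its fibre, and the roots of the minimal
polynomial of `h` depend continuously on the base point, so the point `p` moves along. -/
theorem mem_closure_setOf_algHom_ne_zero {σ B : Type*} [Finite σ] [CommRing B] [IsDomain B]
    [Algebra ℂ B] (π : MvPolynomial σ ℂ →ₐ[ℂ] B) (hπ : Function.Surjective π) (p : B →ₐ[ℂ] ℂ)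
    {c : B} (hc : c ≠ 0) :
    (fun i => p (π (MvPolynomial.X i))) ∈
      closure {v : σ → ℂ | ∃ q : B →ₐ[ℂ] ℂ, q c ≠ 0 ∧ v = fun i => q (π (MvPolynomial.X i))} := by
  have : Fintype σ := Fintype.ofFinite σ
  classical
  have : Algebra.FiniteType ℂ B := Algebra.FiniteType.of_surjective π hπ
  obtain ⟨s, g, hg, hint⟩ := exists_integral_inj_algHom_of_fg ℂ B
  let _ : Algebra (MvPolynomial (Fin s) ℂ) B := g.toRingHom.toAlgebra
  have : Algebra.IsIntegral (MvPolynomial (Fin s) ℂ) B := ⟨hint⟩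
  have : IsScalarTower ℂ (MvPolynomial (Fin s) ℂ) B :=
    IsScalarTower.of_algebraMap_eq fun z => (g.commutes z).symm
  have : FaithfulSMul (MvPolynomial (Fin s) ℂ) B :=
    (faithfulSMul_iff_algebraMap_injective _ _).mpr hg
  have hgmap : ∀ a, algebraMap (MvPolynomial (Fin s) ℂ) B a = g a := fun _ => rfl
  obtain ⟨c', hc', hc'0⟩ := Submodule.exists_mem_ne_zero_of_ne_bot
    (Ideal.comap_ne_bot_of_integral_mem (R := MvPolynomial (Fin s) ℂ) hc
      (Ideal.mem_span_singleton_self c) (Algebra.IsIntegral.isIntegral c))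
  obtain ⟨d, hd⟩ := Ideal.mem_span_singleton'.mp (Ideal.mem_comap.mp hc')
  let b : σ → B := fun i => π (MvPolynomial.X i)
  have hqπ : ∀ (q : B →ₐ[ℂ] ℂ) G, q (π G) = MvPolynomial.aeval (fun i => q (b i)) G := by
    intro q G
    have : q.comp π = MvPolynomial.aeval (fun i => q (b i)) := by
      ext i
      simp [b]
    exact DFunLike.congr_fun this G
  let t₀ : Fin s → ℂ := fun j => p (g (MvPolynomial.X j))
  have hpg : ∀ a, p (g a) = MvPolynomial.aeval t₀ a := by
    intro a
    have : p.comp g = MvPolynomial.aeval t₀ := by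
      ext j
      simp [t₀]
    exact DFunLike.congr_fun this a
  -- the fibre through `p` is finite
  let Fib : Set (σ → ℂ) :=
    {v | ∃ q : B →ₐ[ℂ] ℂ, (∀ a, q (g a) = MvPolynomial.aeval t₀ a) ∧ v = fun i => q (b i)}
  have hFib : Fib.Finite := by
    choose P hPm hP using fun i => Algebra.IsIntegral.isIntegral (R := MvPolynomial (Fin s) ℂ) (b i)
    refine (Set.Finite.pi' (t := fun i => {z | ((P i).map
      (MvPolynomial.aeval t₀ : MvPolynomial (Fin s) ℂ →ₐ[ℂ] ℂ).toRingHom).IsRoot z})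
      fun i => Polynomial.finite_setOfPred_isRoot ((hPm i).map _).ne_zero).subset ?_
    rintro _ ⟨q, hq, rfl⟩ i
    have hcomp : (MvPolynomial.aeval t₀ : MvPolynomial (Fin s) ℂ →ₐ[ℂ] ℂ).toRingHom =
        q.toRingHom.comp (algebraMap _ B) := by
      ext a
      · simp [hgmap]
      · simpa [hgmap] using (hq (MvPolynomial.X a)).symm
    change Polynomial.eval (q (b i)) (Polynomial.map _ (P i)) = 0
    rw [Polynomial.eval_map, hcomp]
    change Polynomial.eval₂ _ (q.toRingHom (b i)) (P i) = 0
    rw [← Polynomial.hom_eval₂, hP i, map_zero]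
  let v₀ : σ → ℂ := fun i => p (b i)
  have : Finite {v // v ∈ Fib ∧ v ≠ v₀} := (hFib.subset fun v hv => hv.1).to_subtype
  obtain ⟨ℓ, hℓ⟩ := Module.exists_dual_forall_apply_ne_zero (K := ℂ)
    (fun v : {v // v ∈ Fib ∧ v ≠ v₀} => v.1 - v₀) fun v => sub_ne_zero.mpr v.2.2
  let h : B := π (∑ i, MvPolynomial.C (ℓ (Pi.single i 1)) * MvPolynomial.X i)
  have hh : ∀ q : B →ₐ[ℂ] ℂ, q h = ℓ fun i => q (b i) := by
    intro q
    rw [hqπ, ℓ.pi_apply_eq_sum_univ]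
    simp only [map_sum, map_mul, MvPolynomial.aeval_X, smul_eq_mul]
    refine Finset.sum_congr rfl fun i _ => ?_
    have hi : (Pi.single i 1 : σ → ℂ) = fun j => if i = j then 1 else 0 := by
      ext j
      simp [Pi.single_apply, eq_comm]
    rw [mul_comm, ← MvPolynomial.algebraMap_eq, AlgHom.commutes, hi]
    rfl
  -- move the base point along an ultrafilter
  have hN : (𝓝[{t : Fin s → ℂ | MvPolynomial.aeval t c' ≠ 0}] t₀).NeBot :=
    mem_closure_iff_nhdsWithin_neBot.mp (dense_setOf_aeval_ne_zero hc'0 t₀)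
  let l := Ultrafilter.of (𝓝[{t : Fin s → ℂ | MvPolynomial.aeval t c' ≠ 0}] t₀)
  have hl : (l : Filter _) ≤ 𝓝[{t : Fin s → ℂ | MvPolynomial.aeval t c' ≠ 0}] t₀ :=
    Ultrafilter.of_le _
  let e : (Fin s → ℂ) → MvPolynomial (Fin s) ℂ →+* ℂ := fun t =>
    (MvPolynomial.aeval t : MvPolynomial (Fin s) ℂ →ₐ[ℂ] ℂ).toRingHom
  have he : ∀ a, Tendsto (fun t => e t a) l (𝓝 (e t₀ a)) := fun a => by
    have : Continuous fun t => e t a := by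
      simpa [e, MvPolynomial.aeval_eq_eval] using MvPolynomial.continuous_eval a
    exact (this.tendsto t₀).mono_left (hl.trans inf_le_left)
  have hroot : (minpoly (MvPolynomial (Fin s) ℂ) h).eval₂ (e t₀) (p h) = 0 := by
    have hcomp : e t₀ = p.toRingHom.comp (algebraMap (MvPolynomial (Fin s) ℂ) B) :=
      RingHom.ext fun a => (hpg a).symm
    rw [hcomp]
    change Polynomial.eval₂ _ (p.toRingHom h) _ = 0
    rw [← Polynomial.hom_eval₂, ← Polynomial.aeval_def, minpoly.aeval, map_zero]
  obtain ⟨z, hz, hzlim⟩ := exists_tendsto_of_eval₂_eq_zero he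
    (minpoly.monic (Algebra.IsIntegral.isIntegral h)) hroot
  choose q hqg hqh using fun t =>
    exists_algHom_of_eval_minpoly_eq_zero h (MvPolynomial.aeval t) (z t) (hz t)
  -- the moving points are bounded, hence converge
  have hbdd : ∀ i, ∃ x, Tendsto (fun t => q t (b i)) l (𝓝 x) := by
    intro i
    obtain ⟨P, hPm, hP⟩ := Algebra.IsIntegral.isIntegral (R := MvPolynomial (Fin s) ℂ) (b i)
    obtain ⟨C, hC⟩ := eventually_norm_le_of_eval₂_eq_zero he (P := P) (by simp [hPm.leadingCoeff])
      (v := fun t => q t (b i)) (Eventually.of_forall fun t => by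
        have hcomp : e t = (q t).toRingHom.comp (algebraMap (MvPolynomial (Fin s) ℂ) B) :=
          RingHom.ext fun a => (hqg t a).symm
        rw [hcomp]
        change Polynomial.eval₂ _ ((q t).toRingHom (b i)) _ = 0
        rw [← Polynomial.hom_eval₂, hP, map_zero])
    exact exists_tendsto_of_eventually_norm_le l hC
  choose w hw using hbdd
  have hwlim : Tendsto (fun t i => q t (b i)) l (𝓝 w) := tendsto_pi_nhds.mpr hw
  -- the limit is a point of the fibre, and `h` identifies it as `p`
  have hlim : ∀ G, Tendsto (fun t => q t (π G)) l (𝓝 (MvPolynomial.aeval w G)) := fun G => by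
    have : Continuous fun x : σ → ℂ => MvPolynomial.aeval x G := by
      simpa [MvPolynomial.aeval_eq_eval] using MvPolynomial.continuous_eval G
    simp only [hqπ]
    exact (this.tendsto w).comp hwlim
  have hker : ∀ G : MvPolynomial σ ℂ, G ∈ RingHom.ker π → MvPolynomial.aeval w G = 0 :=
    fun G hG => by
    have h0 := hlim G
    rw [RingHom.mem_ker.mp hG] at h0
    simp only [map_zero] at h0
    exact tendsto_nhds_unique h0 tendsto_const_nhds
  obtain ⟨qw, hqw'⟩ := exists_algHom_comp_eq_of_isIntegral π
    (π.toRingHom.isIntegral_of_surjective hπ) (MvPolynomial.aeval w) hker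
  have hqw : ∀ G, qw (π G) = MvPolynomial.aeval w G := fun G => DFunLike.congr_fun hqw' G
  have hwFib : w ∈ Fib := by
    refine ⟨qw, fun a => ?_, funext fun i => by simp [b, hqw]⟩
    obtain ⟨G, hG⟩ := hπ (g a)
    rw [← hG, hqw]
    refine tendsto_nhds_unique (hlim G) ?_
    rw [hG]
    exact (he a).congr fun t => (hqg t a).symm
  have hwv : w = v₀ := by
    by_contra hne
    refine hℓ ⟨w, hwFib, hne⟩ ?_
    rw [map_sub, sub_eq_zero]
    have h1 : Tendsto (fun t => q t h) l (𝓝 (p h)) := by simpa only [hqh] using hzlim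
    have h2 : qw h = p h := by
      refine tendsto_nhds_unique ?_ h1
      rw [hqw]
      exact hlim _
    have h3 := hh qw
    rw [h2, hh p] at h3
    have h4 : w = fun i => qw (b i) := funext fun i => by simp [b, hqw]
    exact (congrArg ℓ h4).trans h3.symm
  rw [hwv] at hwlim
  refine mem_closure_of_tendsto hwlim ?_
  filter_upwards [hl self_mem_nhdsWithin] with t ht
  refine ⟨q t, fun h0 => ht ?_, rfl⟩
  rw [← hqg t c', ← hd, map_mul, h0, mul_zero]

/-- The image of an affine variety under a polynomial map has the same Zariski closure as Euclidean
closure. -/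
theorem mem_closure_image_of_mem_zeroLocus {σ τ : Type*} [Finite σ] [Finite τ] {S : Set (τ → ℂ)}
    (hS : MvPolynomial.zeroLocus ℂ (MvPolynomial.vanishingIdeal ℂ S) ⊆ S)
    (Φ : σ → MvPolynomial τ ℂ) {v : σ → ℂ}
    (hv : v ∈ MvPolynomial.zeroLocus ℂ (MvPolynomial.vanishingIdeal ℂ
      ((fun x i => MvPolynomial.eval x (Φ i)) '' S))) :
    v ∈ closure ((fun x i => MvPolynomial.eval x (Φ i)) '' S) := by
  let Ψ : MvPolynomial σ ℂ →ₐ[ℂ] MvPolynomial τ ℂ := MvPolynomial.bind₁ Φ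
  have hΨ : ∀ x G, MvPolynomial.aeval x (Ψ G) =
      MvPolynomial.aeval (fun i => MvPolynomial.eval x (Φ i)) G := fun x G => by
    simp only [Ψ, MvPolynomial.aeval_bind₁, MvPolynomial.aeval_eq_eval]
  have hle : (MvPolynomial.vanishingIdeal ℂ S).comap Ψ ≤ MvPolynomial.vanishingIdeal ℂ {v} := by
    rintro G hG _ rfl
    refine hv G ?_
    rintro _ ⟨x, hx, rfl⟩
    rw [← hΨ]
    exact hG x hx
  obtain ⟨𝔭, h𝔭, h𝔭v⟩ := Ideal.exists_minimalPrimes_le hle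
  have h𝔭prime : 𝔭.IsPrime := h𝔭.1.1
  obtain ⟨Q, hQ, hSQ, hQ𝔭⟩ := Ideal.exists_comap_eq_of_mem_minimalPrimes Ψ.toRingHom 𝔭 h𝔭
  have hQ𝔭' : 𝔭 = Q.comap Ψ := hQ𝔭.symm
  let φ : (MvPolynomial σ ℂ ⧸ 𝔭) →ₐ[ℂ] (MvPolynomial τ ℂ ⧸ Q) :=
    Ideal.quotientMapₐ Q Ψ hQ𝔭'.le
  have hφ : Function.Injective φ := Ideal.quotientMap_injective' (H := hQ𝔭'.le) hQ𝔭'.ge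
  obtain ⟨b, hb, hlift⟩ := exists_ne_zero_forall_exists_algHom_comp_eq φ hφ
  let p : (MvPolynomial σ ℂ ⧸ 𝔭) →ₐ[ℂ] ℂ :=
    Ideal.Quotient.liftₐ 𝔭 (MvPolynomial.aeval v) fun G hG => h𝔭v hG v rfl
  have hmem := mem_closure_setOf_algHom_ne_zero (Ideal.Quotient.mkₐ ℂ 𝔭)
    (Ideal.Quotient.mkₐ_surjective ℂ 𝔭) p hb
  have hpv : (fun i => p (Ideal.Quotient.mkₐ ℂ 𝔭 (MvPolynomial.X i))) = v := by
    ext i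
    simp [p]
  rw [hpv] at hmem
  refine closure_mono ?_ hmem
  rintro _ ⟨q, hq, rfl⟩
  obtain ⟨r, hr⟩ := hlift q hq
  let x : τ → ℂ := fun j => r (Ideal.Quotient.mk Q (MvPolynomial.X j))
  have hx : ∀ G, r (Ideal.Quotient.mk Q G) = MvPolynomial.aeval x G := fun G => by
    have : r.comp (Ideal.Quotient.mkₐ ℂ Q) = MvPolynomial.aeval x := by
      ext j
      simp [x]
    exact DFunLike.congr_fun this G
  refine ⟨x, hS fun G hG => ?_, funext fun i => ?_⟩
  · rw [← hx, Ideal.Quotient.eq_zero_iff_mem.mpr (hSQ hG), map_zero]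
  · rw [← hr]
    have : φ (Ideal.Quotient.mkₐ ℂ 𝔭 (MvPolynomial.X i)) = Ideal.Quotient.mk Q (Φ i) := by
      simp [φ, Ψ]
    rw [AlgHom.comp_apply, this, hx, MvPolynomial.aeval_eq_eval]

/-- The same for the part of an affine variety where a polynomial `a` does not vanish, and for
maps which are polynomial in `x` and `1 / a(x)`. The coordinate `none` stands for `1 / a(x)`. -/
theorem mem_closure_image_ne_zero_of_mem_zeroLocus {σ τ : Type*} [Finite σ] [Finite τ]
    {X : Set (τ → ℂ)} (hX : MvPolynomial.zeroLocus ℂ (MvPolynomial.vanishingIdeal ℂ X) ⊆ X)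
    (a : MvPolynomial τ ℂ) (Φ : σ → MvPolynomial (Option τ) ℂ) {v : σ → ℂ}
    (hv : v ∈ MvPolynomial.zeroLocus ℂ (MvPolynomial.vanishingIdeal ℂ
      ((fun x i => MvPolynomial.eval (fun o => o.elim (MvPolynomial.eval x a)⁻¹ x) (Φ i)) ''
        {x ∈ X | MvPolynomial.eval x a ≠ 0}))) :
    v ∈ closure ((fun x i => MvPolynomial.eval (fun o => o.elim (MvPolynomial.eval x a)⁻¹ x) (Φ i))
      '' {x ∈ X | MvPolynomial.eval x a ≠ 0}) := by
  let ext : (τ → ℂ) → Option τ → ℂ := fun x o => o.elim (MvPolynomial.eval x a)⁻¹ x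
  let S : Set (Option τ → ℂ) := ext '' {x ∈ X | MvPolynomial.eval x a ≠ 0}
  have hsome : ∀ (y : Option τ → ℂ) G, MvPolynomial.aeval y (MvPolynomial.rename some G) =
      MvPolynomial.eval (fun j => y (some j)) G := fun y G => by
    rw [MvPolynomial.aeval_eq_eval]
    exact MvPolynomial.eval_rename some y G
  have hS : MvPolynomial.zeroLocus ℂ (MvPolynomial.vanishingIdeal ℂ S) ⊆ S := by
    intro y hy
    have h1 : y none * MvPolynomial.eval (fun j => y (some j)) a = 1 := by
      have := hy (MvPolynomial.X none * MvPolynomial.rename some a - 1) (by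
        rintro _ ⟨x, ⟨-, hx⟩, rfl⟩
        rw [map_sub, map_mul, hsome]
        simp [ext, hx])
      rwa [map_sub, map_mul, hsome, MvPolynomial.aeval_X, map_one, sub_eq_zero] at this
    refine ⟨fun j => y (some j), ⟨hX fun G hG => ?_, right_ne_zero_of_mul_eq_one h1⟩, ?_⟩
    · have := hy (MvPolynomial.rename some G) (by
        rintro _ ⟨x, ⟨hx, -⟩, rfl⟩
        rw [hsome]
        exact hG x hx)
      rwa [hsome] at this
    · ext o
      cases o with
      | none => exact (eq_inv_of_mul_eq_one_left h1).symm
      | some j => rfl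
  have himage : (fun x i => MvPolynomial.eval (ext x) (Φ i)) ''
      {x ∈ X | MvPolynomial.eval x a ≠ 0} = (fun y i => MvPolynomial.eval y (Φ i)) '' S := by
    rw [Set.image_image]
  change v ∈ closure ((fun x i => MvPolynomial.eval (ext x) (Φ i)) '' _)
  rw [himage]
  refine mem_closure_image_of_mem_zeroLocus hS Φ ?_
  rw [← himage]
  exact hv

/-! ### Affine varieties and their irreducible components -/

theorem IsAffineVariety.zariskiClosure_subset {n : ℕ} {V S : Set (Fin n → ℂ)}
    (hV : IsAffineVariety V) (h : S ⊆ V) : zariskiClosure S ⊆ V := by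
  obtain ⟨I, rfl⟩ := hV
  exact MvPolynomial.zeroLocus_anti_mono (MvPolynomial.le_zeroLocus_iff_le_vanishingIdeal.mp h)

theorem subset_zariskiClosure {n : ℕ} (S : Set (Fin n → ℂ)) : S ⊆ zariskiClosure S :=
  MvPolynomial.zeroLocus_vanishingIdeal_le S

theorem isAffineVariety_zariskiClosure {n : ℕ} (S : Set (Fin n → ℂ)) :
    IsAffineVariety (zariskiClosure S) := ⟨_, rfl⟩

theorem IsAffineVariety.exists_eval_ne_zero {n : ℕ} {V : Set (Fin n → ℂ)} (hV : IsAffineVariety V)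
    {x : Fin n → ℂ} (hx : x ∉ V) :
    ∃ a ∈ MvPolynomial.vanishingIdeal ℂ V, MvPolynomial.eval x a ≠ 0 := by
  by_contra! h
  exact hx (hV.zariskiClosure_subset subset_rfl fun a ha => h a ha)

theorem IsAffineVariety.isClosed {n : ℕ} {V : Set (Fin n → ℂ)} (hV : IsAffineVariety V) :
    IsClosed V := by
  obtain ⟨I, rfl⟩ := hV
  simp only [MvPolynomial.zeroLocus, Set.ofPred_forall]
  refine isClosed_iInter fun p => isClosed_iInter fun _ => ?_
  exact isClosed_eq (by simpa [MvPolynomial.aeval_eq_eval] using MvPolynomial.continuous_eval p)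
    continuous_const

theorem IsAffineVariety.union {n : ℕ} {V W : Set (Fin n → ℂ)} (hV : IsAffineVariety V)
    (hW : IsAffineVariety W) : IsAffineVariety (V ∪ W) := by
  refine ⟨MvPolynomial.vanishingIdeal ℂ (V ∪ W), (subset_zariskiClosure _).antisymm fun x hx => ?_⟩
  by_contra! h
  obtain ⟨hxV, hxW⟩ := not_or.mp h
  obtain ⟨a, ha, hax⟩ := hV.exists_eval_ne_zero hxV
  obtain ⟨b, hb, hbx⟩ := hW.exists_eval_ne_zero hxW
  refine mul_ne_zero hax hbx ?_
  rw [← map_mul]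
  refine hx (a * b) ?_
  rintro z (hz | hz)
  · rw [map_mul, ha z hz, zero_mul]
  · rw [map_mul, hb z hz, mul_zero]

theorem isAffineVariety_empty {n : ℕ} : IsAffineVariety (∅ : Set (Fin n → ℂ)) :=
  ⟨⊤, MvPolynomial.zeroLocus_top.symm⟩

theorem isAffineVariety_biUnion {ι : Type*} {n : ℕ} {s : Set ι} (hs : s.Finite)
    {V : ι → Set (Fin n → ℂ)} (hV : ∀ i ∈ s, IsAffineVariety (V i)) :
    IsAffineVariety (⋃ i ∈ s, V i) := by
  induction s, hs using Set.Finite.induction_on with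
  | empty => simpa using isAffineVariety_empty
  | insert _ _ ih =>
    rw [Set.biUnion_insert]
    exact (hV _ (Set.mem_insert _ _)).union (ih fun i hi => hV i (Set.mem_insert_of_mem _ hi))

theorem IsIrreducibleVariety.exists_subset_of_subset_biUnion {ι : Type*} {n : ℕ}
    {Z : Set (Fin n → ℂ)} (hZ : IsIrreducibleVariety Z) {s : Set ι} (hs : s.Finite)
    {V : ι → Set (Fin n → ℂ)} (hV : ∀ i ∈ s, IsAffineVariety (V i)) (h : Z ⊆ ⋃ i ∈ s, V i) :
    ∃ i ∈ s, Z ⊆ V i := by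
  induction s, hs using Set.Finite.induction_on with
  | empty => simp [hZ.2.1.ne_empty] at h
  | insert _ hs ih =>
    have hV' := fun i hi => hV i (Set.mem_insert_of_mem _ hi)
    rw [Set.biUnion_insert] at h
    obtain h | h := hZ.2.2 _ _ (hV _ (Set.mem_insert _ _)) (isAffineVariety_biUnion hs hV') h
    · exact ⟨_, Set.mem_insert _ _, h⟩
    · obtain ⟨i, hi, h⟩ := ih hV' h
      exact ⟨i, Set.mem_insert_of_mem _ hi, h⟩

theorem isIrreducibleVariety_zeroLocus {n : ℕ} (P : Ideal (MvPolynomial (Fin n) ℂ)) [P.IsPrime] :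
    IsIrreducibleVariety (MvPolynomial.zeroLocus ℂ P) := by
  have hP := MvPolynomial.IsPrime.vanishingIdeal_zeroLocus (K := ℂ) P
  refine ⟨⟨P, rfl⟩, Set.nonempty_iff_ne_empty.mpr fun h => ?_, fun A B hA hB hAB => ?_⟩
  · rw [h, MvPolynomial.vanishingIdeal_empty] at hP
    exact Ideal.IsPrime.ne_top' hP.symm
  · by_contra! h
    obtain ⟨x, hx, hxA⟩ := Set.not_subset.mp h.1
    obtain ⟨y, hy, hyB⟩ := Set.not_subset.mp h.2
    obtain ⟨a, ha, hax⟩ := hA.exists_eval_ne_zero hxA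
    obtain ⟨b, hb, hby⟩ := hB.exists_eval_ne_zero hyB
    have hab : a * b ∈ P := by
      rw [← hP]
      intro z hz
      obtain hz | hz := hAB hz
      · rw [map_mul, ha z hz, zero_mul]
      · rw [map_mul, hb z hz, mul_zero]
    obtain h | h := Ideal.IsPrime.mem_or_mem ‹_› hab
    · exact hax (hx a h)
    · exact hby (hy b h)

theorem IsAffineVariety.eq_biUnion_minimalPrimes {n : ℕ} {V : Set (Fin n → ℂ)}
    (hV : IsAffineVariety V) :
    V = ⋃ P ∈ (MvPolynomial.vanishingIdeal ℂ V).minimalPrimes, MvPolynomial.zeroLocus ℂ P := by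
  refine Set.Subset.antisymm (fun x hx => ?_) (Set.iUnion₂_subset fun P hP => ?_)
  · obtain ⟨P, hP, hPx⟩ := Ideal.exists_minimalPrimes_le
      (MvPolynomial.vanishingIdeal_anti_mono (k := ℂ) (Set.singleton_subset_iff.mpr hx))
    exact Set.mem_biUnion hP fun p hp => hPx hp x rfl
  · exact (MvPolynomial.zeroLocus_anti_mono hP.1.2).trans (hV.zariskiClosure_subset subset_rfl)

theorem isIrreducibleComponent_zeroLocus {n : ℕ} {V : Set (Fin n → ℂ)} (hV : IsAffineVariety V)
    {P : Ideal (MvPolynomial (Fin n) ℂ)}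
    (hP : P ∈ (MvPolynomial.vanishingIdeal ℂ V).minimalPrimes) :
    IsIrreducibleComponent (MvPolynomial.zeroLocus ℂ P) V := by
  have hprime := hP.1.1
  refine ⟨⟨isIrreducibleVariety_zeroLocus P, ?_⟩, fun A hA hPA => ?_⟩
  · rw [hV.eq_biUnion_minimalPrimes]
    exact Set.subset_biUnion_of_mem (u := fun P => MvPolynomial.zeroLocus ℂ P) hP
  · have hsub := hA.2
    rw [hV.eq_biUnion_minimalPrimes] at hsub
    obtain ⟨Q, hQ, hAQ⟩ := hA.1.exists_subset_of_subset_biUnion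
      (Ideal.finite_minimalPrimes_of_isNoetherianRing _ _) (fun P _ => ⟨P, rfl⟩) hsub
    have hQprime := hQ.1.1
    have hQP : Q ≤ P := by
      have := MvPolynomial.vanishingIdeal_anti_mono (k := ℂ) (hPA.trans hAQ)
      rwa [MvPolynomial.IsPrime.vanishingIdeal_zeroLocus,
        MvPolynomial.IsPrime.vanishingIdeal_zeroLocus] at this
    exact hAQ.trans (MvPolynomial.zeroLocus_anti_mono (hP.2 hQ.1 hQP))

theorem exists_isIrreducibleComponent_of_mem {n : ℕ} {V : Set (Fin n → ℂ)}
    (hV : IsAffineVariety V) {x : Fin n → ℂ} (hx : x ∈ V) :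
    ∃ Z, IsIrreducibleComponent Z V ∧ x ∈ Z := by
  rw [hV.eq_biUnion_minimalPrimes] at hx
  obtain ⟨P, hP, hxP⟩ := Set.mem_iUnion₂.mp hx
  exact ⟨_, isIrreducibleComponent_zeroLocus hV hP, hxP⟩

/-- The remaining components `W` of `V`: a variety which together with `Z` covers `V`, but does not
contain `Z`. -/
theorem IsIrreducibleComponent.exists_subset_union {n : ℕ} {Z V : Set (Fin n → ℂ)}
    (hV : IsAffineVariety V) (hZ : IsIrreducibleComponent Z V) :
    ∃ W, IsAffineVariety W ∧ V ⊆ Z ∪ W ∧ ¬ Z ⊆ W := by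
  set M := (MvPolynomial.vanishingIdeal ℂ V).minimalPrimes with hM
  have hfin : M.Finite := Ideal.finite_minimalPrimes_of_isNoetherianRing _ _
  have hsub := hZ.1.2
  rw [hV.eq_biUnion_minimalPrimes] at hsub
  obtain ⟨P, hP, hZP⟩ := hZ.1.1.exists_subset_of_subset_biUnion hfin (fun P _ => ⟨P, rfl⟩) hsub
  have hZeq : MvPolynomial.zeroLocus ℂ P ⊆ Z :=
    hZ.2 (isIrreducibleComponent_zeroLocus hV hP).1 hZP
  have hfin' : (M \ {P}).Finite := hfin.subset Set.sdiff_subset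
  refine ⟨⋃ Q ∈ M \ {P}, MvPolynomial.zeroLocus ℂ Q,
    isAffineVariety_biUnion hfin' fun Q _ => ⟨Q, rfl⟩, fun x hx => ?_, fun hZW => ?_⟩
  · rw [hV.eq_biUnion_minimalPrimes] at hx
    obtain ⟨Q, hQ, hxQ⟩ := Set.mem_iUnion₂.mp hx
    by_cases h : Q = P
    · exact Or.inl (hZeq (h ▸ hxQ))
    · exact Or.inr (Set.mem_biUnion (show Q ∈ M \ {P} from ⟨hQ, h⟩) hxQ)
  · obtain ⟨Q, hQ, hZQ⟩ := hZ.1.1.exists_subset_of_subset_biUnion hfin' (fun Q _ => ⟨Q, rfl⟩) hZW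
    have hPprime := hP.1.1
    have hQprime := hQ.1.1.1
    have hQP : Q ≤ P := by
      have := MvPolynomial.vanishingIdeal_anti_mono (k := ℂ) (hZeq.trans hZQ)
      rwa [MvPolynomial.IsPrime.vanishingIdeal_zeroLocus,
        MvPolynomial.IsPrime.vanishingIdeal_zeroLocus] at this
    exact hQ.2 (le_antisymm hQP (hP.2 hQ.1.1 hQP))

/-- A nonempty Zariski open subset of an irreducible variety is dense in the Euclidean topology. -/
theorem IsIrreducibleVariety.subset_closure_diff {n : ℕ} {Z W : Set (Fin n → ℂ)}
    (hZ : IsIrreducibleVariety Z) (hW : IsAffineVariety W) (hZW : ¬ Z ⊆ W) :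
    Z ⊆ closure (Z \ W) := by
  obtain ⟨x, hx, hxW⟩ := Set.not_subset.mp hZW
  obtain ⟨a, ha, hax⟩ := hW.exists_eval_ne_zero hxW
  have hZa : Z ⊆ zariskiClosure {z ∈ Z | MvPolynomial.eval z a ≠ 0} := by
    obtain h | h := hZ.2.2 _ (MvPolynomial.zeroLocus ℂ (Ideal.span {a}))
      (isAffineVariety_zariskiClosure {z ∈ Z | MvPolynomial.eval z a ≠ 0}) ⟨_, rfl⟩ fun z hz => by
        by_cases h : MvPolynomial.eval z a = 0
        · right
          rw [MvPolynomial.zeroLocus_span]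
          rintro _ rfl
          exact h
        · exact Or.inl (subset_zariskiClosure _ ⟨hz, h⟩)
    · exact h
    · exact absurd (h hx a (Ideal.mem_span_singleton_self a)) hax
  intro z hz
  have key := mem_closure_image_ne_zero_of_mem_zeroLocus (v := z)
    (hZ.1.zariskiClosure_subset subset_rfl) a (fun i => MvPolynomial.X (some i))
  simp only [MvPolynomial.eval_X, Option.elim_some, Set.image_id'] at key
  have hsub : {z ∈ Z | MvPolynomial.eval z a ≠ 0} ⊆ Z \ W :=
    fun w hw => ⟨hw.1, fun h => hw.2 (ha w h)⟩
  exact closure_mono hsub (key (hZa hz))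

/-! ### Properness at a point in terms of integral elements -/

/-- A ring homomorphism of finite type becomes finite after inverting `g` if and only if every
element is integral up to multiplication with a power of `g`. -/
theorem finite_awayMap_iff {B S : Type*} [CommRing B] [CommRing S] {f : B →+* S}
    (hf : f.FiniteType) (g : B) :
    (Localization.awayMap f g).Finite ↔ ∀ x, ∃ n, f.IsIntegralElem (f g ^ n * x) := by
  have hcomm : ∀ b, Localization.awayMap f g (algebraMap B _ b) = algebraMap S _ (f b) :=
    fun b => IsLocalization.map_eq _ b
  let _ := f.toAlgebra
  let _ := (Localization.awayMap f g).toAlgebra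
  have : IsScalarTower B (Localization.Away g) (Localization.Away (f g)) :=
    .of_algebraMap_eq' (IsLocalization.lift_comp _).symm
  constructor
  · intro h x
    have hint : IsIntegral (Localization.Away g) (algebraMap S (Localization.Away (f g)) x) :=
      h.to_isIntegral _
    obtain ⟨⟨_, n, rfl⟩, p, hp, hp'⟩ := hint.exists_multiple_integral_of_isLocalization (.powers g)
    rw [IsScalarTower.algebraMap_eq B S, Submonoid.smul_def, Algebra.smul_def,
      IsScalarTower.algebraMap_apply B S, ← map_mul, ← Polynomial.hom_eval₂,
      IsLocalization.map_eq_zero_iff (.powers (f g))] at hp'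
    obtain ⟨⟨y, m, (rfl : f g ^ m = y)⟩, e⟩ := hp'
    -- clear the denominator `g ^ m` by scaling the roots of `p`
    refine ⟨m + n, Polynomial.X * p.scaleRoots (g ^ m),
      Polynomial.monic_X.mul ((Polynomial.monic_scaleRoots_iff _).mpr hp), ?_⟩
    have key := p.scaleRoots_eval₂_mul f (f (g ^ n) * x) (g ^ m)
    rw [← mul_assoc, map_pow, map_pow, ← pow_add] at key
    rw [Polynomial.eval₂_mul, Polynomial.eval₂_X, key]
    have e' : f g ^ m * Polynomial.eval₂ f (f g ^ n * x) p = 0 := by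
      rw [← map_pow f g n]
      exact e
    obtain h0 | ⟨d, hd⟩ : p.natDegree = 0 ∨ ∃ d, p.natDegree = d + 1 := by
      cases p.natDegree with
      | zero => exact Or.inl rfl
      | succ d => exact Or.inr ⟨d, rfl⟩
    · rw [h0, pow_zero, one_mul, pow_add]
      linear_combination (f g ^ n * x) * e'
    · rw [hd, pow_succ]
      linear_combination (f g ^ (m + n) * x) * (f g ^ m) ^ d * e'
  · intro h
    refine RingHom.IsIntegral.to_finite (fun z => ?_) ?_
    · obtain ⟨⟨x, ⟨_, k, rfl⟩⟩, hz⟩ := IsLocalization.surj (Submonoid.powers (f g)) z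
      obtain ⟨n, p, hp, hpx⟩ := h x
      have hint : IsIntegral (Localization.Away g)
          (algebraMap S (Localization.Away (f g)) (f g ^ n * x)) := by
        refine ⟨p.map (algebraMap B _), hp.map _, ?_⟩
        rw [Polynomial.eval₂_map, ← IsScalarTower.algebraMap_eq,
          IsScalarTower.algebraMap_eq B S, ← Polynomial.hom_eval₂]
        exact (congrArg _ hpx).trans (map_zero _)
      have hunit : IsUnit (algebraMap B (Localization.Away g) g) :=
        IsLocalization.Away.algebraMap_isUnit g
      obtain ⟨u, hu⟩ := hunit.exists_left_inv
      have hu' : Localization.awayMap f g u * algebraMap S (Localization.Away (f g)) (f g) = 1 := by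
        rw [← hcomm, ← map_mul, hu, map_one]
      have hz' : z = Localization.awayMap f g (u ^ (k + n)) *
          algebraMap S (Localization.Away (f g)) (f g ^ n * x) := by
        simp only [map_pow, map_mul] at hz ⊢
        rw [← hz]
        calc z = z * (Localization.awayMap f g u *
                algebraMap S (Localization.Away (f g)) (f g)) ^ (k + n) := by
              rw [hu', one_pow, mul_one]
          _ = _ := by ring
      rw [hz']
      exact (isIntegral_algebraMap (R := Localization.Away g)).mul hint
    · refine RingHom.FiniteType.of_comp_finiteType (f := algebraMap B (Localization.Away g)) ?_
      have : (Localization.awayMap f g).comp (algebraMap B (Localization.Away g)) =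
          (algebraMap S (Localization.Away (f g))).comp f := RingHom.ext hcomm
      rw [this]
      refine RingHom.FiniteType.comp ?_ hf
      rw [RingHom.finiteType_algebraMap]
      exact IsLocalization.finiteType_of_monoid_fg (Submonoid.powers (f g)) _

theorem isFinite_restrict_basicOpen_iff {R S : CommRingCat} (f : R ⟶ S) (hf : f.hom.FiniteType)
    (g : R) : IsFinite (Spec.map f ∣_ (PrimeSpectrum.basicOpen g)) ↔
      ∀ x, ∃ n, f.hom.IsIntegralElem (f.hom g ^ n * x) := by
  have : MorphismProperty.RespectsIso @IsFinite :=
    MorphismProperty.IsStableUnderBaseChange.respectsIso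
  rw [(MorphismProperty.arrow_mk_iso_iff @IsFinite (SpecMapRestrictBasicOpenIso f g)),
    IsFinite.SpecMap_iff]
  exact finite_awayMap_iff hf g

theorem isFinite_restrict_of_le {X Y : Scheme} (f : X ⟶ Y) {U V : Y.Opens} (h : V ≤ U)
    [IsFinite (f ∣_ U)] : IsFinite (f ∣_ V) := by
  have : MorphismProperty.RespectsIso @IsFinite :=
    MorphismProperty.IsStableUnderBaseChange.respectsIso
  have hV : U.ι ''ᵁ (U.ι ⁻¹ᵁ V) = V := by
    rw [Scheme.Hom.image_preimage_eq_opensRange_inf, Scheme.Opens.opensRange_ι]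
    exact inf_eq_right.mpr h
  have h1 : IsFinite (f ∣_ U ∣_ (U.ι ⁻¹ᵁ V)) := inferInstance
  have h2 := (MorphismProperty.arrow_mk_iso_iff @IsFinite
    (morphismRestrictRestrict f U (U.ι ⁻¹ᵁ V))).mp h1
  exact (MorphismProperty.arrow_mk_iso_iff @IsFinite (morphismRestrictEq f hV)).mp h2

section

variable {n m : ℕ} (F : Fin m → MvPolynomial (Fin n) ℂ) (X : Set (Fin n → ℂ))

theorem evalAt_mk {V : Set (Fin n → ℂ)} (v : V) (G : MvPolynomial (Fin n) ℂ) :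
    evalAt V v (Ideal.Quotient.mk _ G) = MvPolynomial.eval (v : Fin n → ℂ) G := rfl

theorem finiteType_pullback : (pullback F X).FiniteType := by
  refine RingHom.FiniteType.of_comp_finiteType (f := algebraMap ℂ _) ?_
  have : (pullback F X).comp (algebraMap ℂ _) = algebraMap ℂ _ := by
    ext z
    change Ideal.Quotient.mk _ (MvPolynomial.bind₁ F (MvPolynomial.C z)) = _
    rw [MvPolynomial.bind₁_C_right]
    rfl
  rw [this]
  exact RingHom.finiteType_algebraMap.mpr inferInstance

theorem isProperAtPoint_iff_exists_basicOpen (y : closureImage F X) :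
    IsProperAtPoint F X y ↔ ∃ g, evalAt _ y g ≠ 0 ∧
      ∀ x, ∃ k, (pullback F X).IsIntegralElem (pullback F X g ^ k * x) := by
  have hmem : ∀ g : CoordRing (closureImage F X), (toPoint (closureImage F X) y :
      PrimeSpectrum (CoordRing (closureImage F X))) ∈ PrimeSpectrum.basicOpen g ↔
        evalAt _ y g ≠ 0 := fun g => not_congr RingHom.mem_ker
  have hft := finiteType_pullback F X
  constructor
  · rintro ⟨U, -, hyU, hfin⟩
    obtain ⟨_, ⟨g, rfl⟩, hyg, hgU⟩ :=
      PrimeSpectrum.isTopologicalBasis_basic_opens.exists_subset_of_mem_open hyU U.isOpen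
    refine ⟨g, (hmem g).mp hyg, ?_⟩
    have := isFinite_restrict_of_le (toMorphism F X) (V := PrimeSpectrum.basicOpen g) hgU
    exact (isFinite_restrict_basicOpen_iff (CommRingCat.ofHom (pullback F X)) hft g).mp this
  · rintro ⟨g, hg, hfin⟩
    exact ⟨PrimeSpectrum.basicOpen g, IsAffineOpen.Spec_basicOpen (R := .of _) g, (hmem g).mpr hg,
      (isFinite_restrict_basicOpen_iff (CommRingCat.ofHom (pullback F X)) hft g).mpr hfin⟩

/-- Properness at `y` only has to be tested on the coordinate functions. -/
theorem isProperAtPoint_iff_forall_coordinate (y : closureImage F X) :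
    IsProperAtPoint F X y ↔ ∀ i, ∃ c, evalAt _ y c ≠ 0 ∧ (pullback F X).IsIntegralElem
      (pullback F X c * Ideal.Quotient.mk _ (MvPolynomial.X i)) := by
  rw [isProperAtPoint_iff_exists_basicOpen]
  constructor
  · rintro ⟨g, hg, h⟩ i
    obtain ⟨k, hk⟩ := h (Ideal.Quotient.mk _ (MvPolynomial.X i))
    exact ⟨g ^ k, by rw [map_pow]; exact pow_ne_zero k hg, by rwa [map_pow]⟩
  · intro h
    choose c hc hint using h
    refine ⟨∏ i, c i, by rw [map_prod]; exact Finset.prod_ne_zero_iff.mpr fun i _ => hc i, ?_⟩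
    intro x
    obtain ⟨G, rfl⟩ := Ideal.Quotient.mk_surjective x
    have hmul : ∀ b, (pullback F X).IsIntegralElem (pullback F X b) := fun b =>
      (pullback F X).isIntegralElem_map
    have hpow : ∀ b k, (pullback F X).IsIntegralElem (pullback F X b ^ k) := fun b k => by
      rw [← map_pow]
      exact hmul _
    induction G using MvPolynomial.induction_on with
    | C z =>
      refine ⟨0, ?_⟩
      have : Ideal.Quotient.mk (MvPolynomial.vanishingIdeal ℂ X) (MvPolynomial.C z) =
          pullback F X (Ideal.Quotient.mk _ (MvPolynomial.C z)) := by
        change _ = Ideal.Quotient.mk _ (MvPolynomial.bind₁ F (MvPolynomial.C z))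
        rw [MvPolynomial.bind₁_C_right]
      rw [pow_zero, one_mul, this]
      exact hmul _
    | add p q hp hq =>
      obtain ⟨k, hk⟩ := hp
      obtain ⟨l, hl⟩ := hq
      refine ⟨k + l, ?_⟩
      have := ((hpow (∏ i, c i) l).mul _ hk).add _ ((hpow (∏ i, c i) k).mul _ hl)
      convert! this using 1
      rw [map_add]
      ring
    | mul_X p i hp =>
      obtain ⟨k, hk⟩ := hp
      refine ⟨k + 1, ?_⟩
      have := (hk.mul _ (hint i)).mul _ (hmul (∏ j ∈ Finset.univ.erase i, c j))
      convert! this using 1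
      rw [pow_succ, map_mul, ← Finset.mul_prod_erase _ _ (Finset.mem_univ i), map_mul]
      ring

end

/-! ### The non-properness set in terms of limits -/

section

variable {n m : ℕ} (F : Fin m → MvPolynomial (Fin n) ℂ) (X : Set (Fin n → ℂ))

theorem polyMap_mem_closureImage {X : Set (Fin n → ℂ)} {x : Fin n → ℂ} (hx : x ∈ X) :
    polyMap F x ∈ closureImage F X :=
  subset_zariskiClosure _ ⟨x, hx, rfl⟩

theorem eval_bind₁_eq_eval_polyMap (x : Fin n → ℂ) (G : MvPolynomial (Fin m) ℂ) :
    MvPolynomial.eval x (MvPolynomial.bind₁ F G) = MvPolynomial.eval (polyMap F x) G := by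
  have : MvPolynomial.aeval x (MvPolynomial.bind₁ F G) = MvPolynomial.aeval (polyMap F x) G := by
    simp only [MvPolynomial.aeval_bind₁, MvPolynomial.aeval_eq_eval]
    rfl
  simpa only [MvPolynomial.aeval_eq_eval] using this

theorem evalAt_comp_pullback (x : X) :
    (evalAt X x).comp (pullback F X) =
      evalAt _ ⟨polyMap F x, polyMap_mem_closureImage F x.2⟩ := by
  refine RingHom.ext fun b => ?_
  obtain ⟨G, rfl⟩ := Ideal.Quotient.mk_surjective b
  exact eval_bind₁_eq_eval_polyMap F x G

/-- A value approached along points of `X` tending to infinity belongs to the non-properness set: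
near a point where `F` is proper the coordinates satisfy integral equations, so they are bounded. -/
theorem mem_nonProperSet_of_tendsto {ι : Type*} {l : Filter ι} [l.NeBot] {x : ι → Fin n → ℂ}
    (hx : ∀ k, x k ∈ X) {y : Fin m → ℂ} (hy : Tendsto (fun k => polyMap F (x k)) l (𝓝 y))
    (hinf : Tendsto (fun k => ‖x k‖) l atTop) : y ∈ nonProperSet F X := by
  have hmem : ∀ k, polyMap F (x k) ∈ closureImage F X := fun k => polyMap_mem_closureImage F (hx k)
  have hyY : y ∈ closureImage F X :=
    (isAffineVariety_zariskiClosure _).isClosed.mem_of_tendsto hy (Eventually.of_forall hmem)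
  refine ⟨hyY, fun hprop => ?_⟩
  rw [isProperAtPoint_iff_forall_coordinate] at hprop
  let e : ι → CoordRing (closureImage F X) →+* ℂ := fun k => evalAt _ ⟨polyMap F (x k), hmem k⟩
  have he : ∀ b, Tendsto (fun k => e k b) l (𝓝 (evalAt _ ⟨y, hyY⟩ b)) := fun b => by
    obtain ⟨G, rfl⟩ := Ideal.Quotient.mk_surjective b
    exact ((MvPolynomial.continuous_eval G).tendsto y).comp hy
  have hbdd : ∀ i, ∃ C, ∀ᶠ k in l, ‖x k i‖ ≤ C := by
    intro i
    obtain ⟨c, hc, P, hP, hPx⟩ := hprop i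
    obtain ⟨C, hC⟩ := eventually_norm_le_of_eval₂_eq_zero he (P := P) (by simp [hP.leadingCoeff])
      (v := fun k => e k c * x k i) (Eventually.of_forall fun k => by
        have h0 := congrArg (evalAt X ⟨x k, hx k⟩) hPx
        rw [Polynomial.hom_eval₂, map_zero, evalAt_comp_pullback F X, map_mul,
          ← RingHom.comp_apply, evalAt_comp_pullback F X, evalAt_mk, MvPolynomial.eval_X] at h0
        exact h0)
    have hc0 : 0 < ‖evalAt _ ⟨y, hyY⟩ c‖ := norm_pos_iff.mpr hc
    refine ⟨C / (‖evalAt _ ⟨y, hyY⟩ c‖ / 2), ?_⟩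
    filter_upwards [hC, (he c).norm.eventually_const_lt (half_lt_self hc0)] with k h1 h2
    rw [le_div_iff₀ (by positivity), mul_comm]
    rw [norm_mul] at h1
    exact (mul_le_mul_of_nonneg_right h2.le (norm_nonneg _)).trans h1
  choose C hC using hbdd
  have hall : ∀ᶠ k in l, ‖x k‖ ≤ ∑ i, |C i| := by
    filter_upwards [eventually_all.mpr hC] with k hk
    refine (pi_norm_le_iff_of_nonneg (Finset.sum_nonneg fun i _ => abs_nonneg _)).mpr fun i => ?_
    exact ((hk i).trans (le_abs_self _)).trans
      (Finset.single_le_sum (f := fun i => |C i|) (fun i _ => abs_nonneg _) (Finset.mem_univ i))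
  obtain ⟨k, h1, h2⟩ := (hall.and (hinf.eventually_gt_atTop (∑ i, |C i|))).exists
  exact absurd h1 (not_le.mpr h2)

theorem mk_eq_zero_of_forall_eval_eq_zero {X A : Set (Fin n → ℂ)}
    (hdense : X ⊆ zariskiClosure (X \ A)) {G : MvPolynomial (Fin n) ℂ}
    (hG : ∀ x ∈ X \ A, MvPolynomial.eval x G = 0) :
    Ideal.Quotient.mk (MvPolynomial.vanishingIdeal ℂ X) G = 0 :=
  Ideal.Quotient.eq_zero_iff_mem.mpr fun _ hx => hdense hx G hG

/-- If the coordinate `xᵢ` is not integral over the local ring of `y`, then `(y, 0)` lies in the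
Zariski closure of the image of `x ↦ (F(x), 1 / xᵢ)`: a polynomial `G` in `(y, s)` vanishing on
that image, but not at `(y, 0)`, turns into an integral equation of `xᵢ` when it is multiplied by
a power of `xᵢ`. -/
theorem eval_eq_zero_of_not_isIntegralElem {X A : Set (Fin n → ℂ)}
    (hdense : X ⊆ zariskiClosure (X \ A)) {y : Fin m → ℂ} (hy : y ∈ closureImage F X) {i : Fin n}
    (hi : ∀ c, evalAt _ ⟨y, hy⟩ c ≠ 0 → ¬ (pullback F X).IsIntegralElem
      (pullback F X c * Ideal.Quotient.mk _ (MvPolynomial.X i)))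
    {G : MvPolynomial (Option (Fin m)) ℂ}
    (hG : ∀ x ∈ X \ A, x i ≠ 0 →
      MvPolynomial.eval (fun o => o.elim (x i)⁻¹ (polyMap F x)) G = 0) :
    MvPolynomial.eval (fun o => o.elim 0 y) G = 0 := by
  by_contra hne
  set G' := MvPolynomial.optionEquivLeft ℂ (Fin m) G
  simp only [MvPolynomial.optionEquivLeft_elim_eval] at hG hne
  let B := CoordRing (closureImage F X)
  let mk : MvPolynomial (Fin m) ℂ →+* B := Ideal.Quotient.mk _
  let N := G'.natDegree
  let c : B := mk (G'.coeff 0)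
  have hc : evalAt _ ⟨y, hy⟩ c ≠ 0 := by
    rw [← Polynomial.coeff_zero_eq_eval_zero, Polynomial.coeff_map] at hne
    exact hne
  have hc0 : c ≠ 0 := fun h => hc (by rw [h, map_zero])
  let P : Polynomial B := (Polynomial.reflect N G').map mk * Polynomial.X
  have hcoeff : ((Polynomial.reflect N G').map mk).coeff N = c := by
    rw [Polynomial.coeff_map, Polynomial.coeff_reflect, Polynomial.revAt_le le_rfl, Nat.sub_self]
  have hdeg : ((Polynomial.reflect N G').map mk).natDegree = N := by
    refine le_antisymm ?_ (Polynomial.le_natDegree_of_ne_zero (hcoeff ▸ hc0))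
    refine Polynomial.natDegree_map_le.trans (Polynomial.natDegree_le_iff_coeff_eq_zero.mpr ?_)
    intro j hj
    rw [Polynomial.coeff_reflect, Polynomial.revAt_eq_self_of_lt hj]
    exact Polynomial.coeff_eq_zero_of_natDegree_lt hj
  have hlead : P.leadingCoeff = c := by
    rw [Polynomial.leadingCoeff_mul_X, Polynomial.leadingCoeff, hdeg, hcoeff]
  refine hi c hc (hlead ▸ (pullback F X).isIntegralElem_leadingCoeff_mul P _ ?_)
  -- the equation may be checked on the dense set `X \ A`
  obtain ⟨H, hH⟩ := Ideal.Quotient.mk_surjective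
    (P.eval₂ (pullback F X) (Ideal.Quotient.mk _ (MvPolynomial.X i)))
  rw [← hH]
  refine mk_eq_zero_of_forall_eval_eq_zero hdense fun x hx => ?_
  have h1 := congrArg (evalAt X ⟨x, hx.1⟩) hH
  rw [Polynomial.hom_eval₂, evalAt_comp_pullback F X, evalAt_mk, evalAt_mk,
    MvPolynomial.eval_X, Polynomial.eval₂_mul, Polynomial.eval₂_X, Polynomial.eval₂_map] at h1
  rw [h1]
  change Polynomial.eval₂ (MvPolynomial.eval (polyMap F x)) (x i) _ * x i = 0
  by_cases hxi : x i = 0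
  · rw [hxi, mul_zero]
  · have hinv : Invertible (x i)⁻¹ := invertibleOfNonzero (inv_ne_zero hxi)
    have h2 := (Polynomial.eval₂_reflect_eq_zero_iff (MvPolynomial.eval (polyMap F x)) (x i)⁻¹ N G'
      le_rfl).mpr (by
        rw [← Polynomial.eval_map]
        exact hG x hx hxi)
    rw [invOf_eq_inv, inv_inv] at h2
    rw [h2, zero_mul]

/-- Every point of the non-properness set is approached along points of `X \ A` tending to
infinity, if `X \ A` is a Zariski open and dense subset of `X`. -/
theorem exists_tendsto_of_mem_nonProperSet {X A : Set (Fin n → ℂ)} (hX : IsAffineVariety X)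
    (hA : IsAffineVariety A) (hdense : X ⊆ zariskiClosure (X \ A)) {y : Fin m → ℂ}
    (hy : y ∈ nonProperSet F X) :
    ∃ (ι : Type) (l : Ultrafilter ι) (x : ι → Fin n → ℂ), (∀ k, x k ∈ X \ A) ∧
      Tendsto (fun k => polyMap F (x k)) l (𝓝 y) ∧ Tendsto (fun k => ‖x k‖) l atTop := by
  obtain ⟨hyY, hnp⟩ := hy
  rw [isProperAtPoint_iff_forall_coordinate] at hnp
  push Not at hnp
  obtain ⟨i, hi⟩ := hnp
  let v : Option (Fin m) → ℂ := fun o => o.elim 0 y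
  let img : (Fin n → ℂ) → Option (Fin m) → ℂ := fun x o => o.elim (x i)⁻¹ (polyMap F x)
  let D : MvPolynomial (Fin n) ℂ → Set (Fin n → ℂ) := fun a =>
    {x ∈ X | MvPolynomial.eval x (a * MvPolynomial.X i) ≠ 0}
  -- one of finitely many polynomials cutting out `A` will do
  obtain ⟨a, haA, ha⟩ : ∃ a ∈ MvPolynomial.vanishingIdeal ℂ A,
      v ∈ MvPolynomial.zeroLocus ℂ (MvPolynomial.vanishingIdeal ℂ (img '' D a)) := by
    obtain ⟨T, hT⟩ := (isNoetherianRing_iff_ideal_fg _).mp inferInstance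
      (MvPolynomial.vanishingIdeal ℂ A)
    by_contra! hcon
    have hG : ∀ a : MvPolynomial (Fin n) ℂ, ∃ G : MvPolynomial (Option (Fin m)) ℂ,
        a ∈ MvPolynomial.vanishingIdeal ℂ A →
          (∀ x ∈ D a, MvPolynomial.eval (img x) G = 0) ∧ MvPolynomial.eval v G ≠ 0 := by
      intro a
      by_cases haA : a ∈ MvPolynomial.vanishingIdeal ℂ A
      · have := hcon a haA
        rw [MvPolynomial.mem_zeroLocus_iff] at this
        push Not at this
        obtain ⟨G, hG, hGv⟩ := this
        exact ⟨G, fun _ => ⟨fun x hx => hG _ ⟨x, hx, rfl⟩, hGv⟩⟩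
      · exact ⟨0, fun h => absurd h haA⟩
    choose G hG using hG
    have hTA : ∀ a ∈ T, a ∈ MvPolynomial.vanishingIdeal ℂ A := fun a ha =>
      hT ▸ Ideal.subset_span ha
    have hprod := eval_eq_zero_of_not_isIntegralElem F hdense hyY hi (G := ∏ a ∈ T, G a)
      fun x hx hxi => by
        obtain ⟨a, haT, hax⟩ : ∃ a ∈ T, MvPolynomial.eval x a ≠ 0 := by
          by_contra! h0
          refine hx.2 (hA.zariskiClosure_subset subset_rfl ?_)
          change x ∈ MvPolynomial.zeroLocus ℂ _
          rw [← hT, MvPolynomial.zeroLocus_span]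
          exact h0
        rw [map_prod]
        exact Finset.prod_eq_zero haT ((hG a (hTA a haT)).1 x ⟨hx.1, by simp [hax, hxi]⟩)
    rw [map_prod, Finset.prod_eq_zero_iff] at hprod
    obtain ⟨a, haT, ha0⟩ := hprod
    exact (hG a (hTA a haT)).2 ha0
  let Φ : Option (Fin m) → MvPolynomial (Option (Fin n)) ℂ := fun o =>
    o.elim (MvPolynomial.X none * MvPolynomial.rename some a)
      fun j => MvPolynomial.rename some (F j)
  have himg : ∀ x ∈ D a, (fun o => MvPolynomial.eval (fun o' : Option (Fin n) =>
      o'.elim (MvPolynomial.eval x (a * MvPolynomial.X i))⁻¹ x) (Φ o)) = img x := by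
    rintro x ⟨-, hx⟩
    rw [map_mul, MvPolynomial.eval_X] at hx
    ext o
    cases o with
    | none =>
      simp only [Φ, img, Option.elim_none, map_mul, MvPolynomial.eval_X, MvPolynomial.eval_rename]
      change _ * MvPolynomial.eval x a = _
      have h1 := left_ne_zero_of_mul hx
      rw [mul_inv, mul_comm, ← mul_assoc, mul_inv_cancel₀ h1, one_mul]
    | some j =>
      simp only [Φ, img, Option.elim_some, MvPolynomial.eval_rename]
      rfl
  have hcl := mem_closure_image_ne_zero_of_mem_zeroLocus (v := v)
    (hX.zariskiClosure_subset subset_rfl) (a * MvPolynomial.X i) Φ (by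
      rw [Set.image_congr himg]
      exact ha)
  rw [Set.image_congr himg] at hcl
  have hne : (comap (fun x : D a => img x) (𝓝 v)).NeBot := by
    refine comap_neBot fun t ht => ?_
    obtain ⟨_, hw, x, hx, rfl⟩ := mem_closure_iff_nhds.mp hcl t ht
    exact ⟨⟨x, hx⟩, hw⟩
  let l := Ultrafilter.of (comap (fun x : D a => img x) (𝓝 v))
  have hl : Tendsto (fun x : D a => img x) l (𝓝 v) :=
    tendsto_comap.mono_left (Ultrafilter.of_le _)
  rw [tendsto_pi_nhds] at hl
  have hD : ∀ x ∈ D a, MvPolynomial.eval x a ≠ 0 ∧ x i ≠ 0 := fun x hx => by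
    have := hx.2
    rw [map_mul, MvPolynomial.eval_X] at this
    exact ⟨left_ne_zero_of_mul this, right_ne_zero_of_mul this⟩
  refine ⟨D a, l, fun x => x, fun x => ⟨x.2.1, fun hxA => (hD x x.2).1 (haA x hxA)⟩,
    tendsto_pi_nhds.mpr fun j => hl (some j), ?_⟩
  have h0 : Tendsto (fun x : D a => ‖((x : Fin n → ℂ) i)⁻¹‖) l (𝓝[>] 0) := by
    refine tendsto_nhdsWithin_iff.mpr
      ⟨by simpa [img, v] using (hl none).norm, Eventually.of_forall ?_⟩
    intro x
    exact norm_pos_iff.mpr (inv_ne_zero (hD x x.2).2)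
  refine tendsto_atTop_mono (fun x => ?_) h0.inv_tendsto_nhdsGT_zero
  simpa using norm_le_pi_norm (x : Fin n → ℂ) i

theorem isAffineVariety_nonProperSet : IsAffineVariety (nonProperSet F X) := by
  refine ⟨MvPolynomial.vanishingIdeal ℂ (nonProperSet F X),
    (subset_zariskiClosure _).antisymm fun y hy => ?_⟩
  have hyY : y ∈ closureImage F X :=
    (isAffineVariety_zariskiClosure _).zariskiClosure_subset (fun z hz => hz.1) hy
  refine ⟨hyY, fun hprop => ?_⟩
  -- properness is an open condition: it holds on a whole basic open set around `y`
  obtain ⟨g, hg, hint⟩ := (isProperAtPoint_iff_exists_basicOpen F X _).mp hprop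
  obtain ⟨G, rfl⟩ := Ideal.Quotient.mk_surjective g
  refine hg (hy G fun z hz => ?_)
  by_contra h
  exact hz.2 ((isProperAtPoint_iff_exists_basicOpen F X _).mpr ⟨_, h, hint⟩)

end

/-! ### Parametric curves and their limits -/

section

variable {n D : ℕ}

/-- The polynomial map `t ↦ c₀ + t c₁ + ⋯ + t ^ D c_D` with vector coefficients `cⱼ`. -/
noncomputable def curve (c : Fin (D + 1) → Fin n → ℂ) (t : ℂ) : Fin n → ℂ :=
  ∑ j : Fin (D + 1), t ^ (j : ℕ) • c j

/-- The sum of the norms of the nonconstant coefficients; it vanishes exactly for constant maps. -/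
noncomputable def curveNorm (c : Fin (D + 1) → Fin n → ℂ) : ℝ :=
  ∑ j : Fin D, ‖c j.succ‖

/-- The components of `curve c` as polynomials. -/
noncomputable def curvePoly (c : Fin (D + 1) → Fin n → ℂ) (i : Fin n) : Polynomial ℂ :=
  ∑ j : Fin (D + 1), Polynomial.C (c j i) * Polynomial.X ^ (j : ℕ)

theorem curve_apply (c : Fin (D + 1) → Fin n → ℂ) (t : ℂ) (i : Fin n) :
    curve c t i = ∑ j : Fin (D + 1), t ^ (j : ℕ) * c j i := by
  simp [curve]

theorem eval_curvePoly (c : Fin (D + 1) → Fin n → ℂ) (t : ℂ) (i : Fin n) :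
    (curvePoly c i).eval t = curve c t i := by
  rw [curve_apply, curvePoly, Polynomial.eval_finsetSum]
  refine Finset.sum_congr rfl fun j _ => ?_
  rw [Polynomial.eval_mul, Polynomial.eval_C, Polynomial.eval_pow, Polynomial.eval_X, mul_comm]

theorem coeff_curvePoly (c : Fin (D + 1) → Fin n → ℂ) (i : Fin n) (j : Fin (D + 1)) :
    (curvePoly c i).coeff j = c j i := by
  simp [curvePoly, Polynomial.finsetSum_coeff, Polynomial.coeff_C_mul, Polynomial.coeff_X_pow,
    Fin.val_inj]

theorem natDegree_curvePoly_le (c : Fin (D + 1) → Fin n → ℂ) (i : Fin n) :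
    (curvePoly c i).natDegree ≤ D :=
  Polynomial.natDegree_sum_le_of_forall_le _ _ fun j _ =>
    (Polynomial.natDegree_C_mul_X_pow_le _ _).trans (Nat.lt_succ_iff.mp j.2)

theorem curve_coeff {φ : Fin n → Polynomial ℂ} (hφ : ∀ i, (φ i).natDegree ≤ D) (t : ℂ) :
    curve (fun (j : Fin (D + 1)) i => (φ i).coeff j) t = fun i => (φ i).eval t := by
  ext i
  rw [curve_apply, Polynomial.eval_eq_sum_range' (Nat.lt_succ_iff.mpr (hφ i)),
    ← Fin.sum_univ_eq_sum_range fun j => (φ i).coeff j * t ^ j]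
  simp only [mul_comm]

theorem curve_zero (c : Fin (D + 1) → Fin n → ℂ) : curve c 0 = c 0 := by
  simp [curve, Fin.sum_univ_succ]

theorem exists_ne_zero_of_curveNorm_ne_zero {c : Fin (D + 1) → Fin n → ℂ} (hc : curveNorm c ≠ 0) :
    ∃ j : Fin D, c j.succ ≠ 0 := by
  by_contra! h
  exact hc (by simp [curveNorm, h])

theorem curve_eq_of_curveNorm_eq_zero {c : Fin (D + 1) → Fin n → ℂ} (hc : curveNorm c = 0)
    (t : ℂ) : curve c t = c 0 := by
  have h : ∀ j : Fin D, c j.succ = 0 := fun j =>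
    norm_eq_zero.mp ((Finset.sum_eq_zero_iff_of_nonneg fun _ _ => norm_nonneg _).mp hc j
      (Finset.mem_univ j))
  simp [curve, Fin.sum_univ_succ, h]

theorem isParametricCurve_range_curve {c : Fin (D + 1) → Fin n → ℂ} (hc : curveNorm c ≠ 0) :
    IsParametricCurve D (Set.range (curve c)) := by
  obtain ⟨j, hj⟩ := exists_ne_zero_of_curveNorm_ne_zero hc
  obtain ⟨i, hi⟩ := Function.ne_iff.mp hj
  refine ⟨curvePoly c, natDegree_curvePoly_le c, ⟨i, ?_⟩, ?_⟩
  · have : (j.succ : ℕ) ≤ (curvePoly c i).natDegree :=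
      Polynomial.le_natDegree_of_ne_zero (by rw [coeff_curvePoly]; exact hi)
    exact (by simp : 0 < (j.succ : ℕ)).trans_le this
  · simp only [eval_curvePoly]

theorem IsParametricCurve.exists_curve {Γ : Set (Fin n → ℂ)} (hΓ : IsParametricCurve D Γ)
    {x : Fin n → ℂ} (hx : x ∈ Γ) :
    ∃ c : Fin (D + 1) → Fin n → ℂ, c 0 = x ∧ curveNorm c ≠ 0 ∧ Set.range (curve c) = Γ := by
  obtain ⟨φ, hdeg, ⟨i, hi⟩, rfl⟩ := hΓ
  obtain ⟨t₀, rfl⟩ := hx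
  let ψ : Fin n → Polynomial ℂ := fun i => (φ i).comp (Polynomial.X + Polynomial.C t₀)
  have hψdeg : ∀ i, (ψ i).natDegree = (φ i).natDegree := fun i => by
    rw [Polynomial.natDegree_comp, Polynomial.natDegree_X_add_C, mul_one]
  have hcurve := curve_coeff (D := D) (φ := ψ) fun i => (hψdeg i).trans_le (hdeg i)
  have hψ : ∀ t, (fun i => (ψ i).eval t) = fun i => (φ i).eval (t + t₀) := fun t => by
    ext i
    simp [ψ]
  refine ⟨fun j i => (ψ i).coeff j, ?_, fun h0 => ?_, ?_⟩
  · exact (curve_zero _).symm.trans (by rw [hcurve, hψ, zero_add])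
  · have hconst := curve_eq_of_curveNorm_eq_zero h0
    have hC : ψ i = Polynomial.C ((ψ i).coeff 0) := Polynomial.funext fun t => by
      have := congrFun (hconst t) i
      rw [hcurve] at this
      simpa using this
    have := hψdeg i
    rw [hC, Polynomial.natDegree_C] at this
    omega
  · ext z
    constructor
    · rintro ⟨t, rfl⟩
      exact ⟨t + t₀, by rw [hcurve, hψ]⟩
    · rintro ⟨t, rfl⟩
      exact ⟨t - t₀, by rw [hcurve, hψ, sub_add_cancel]⟩

theorem continuous_curve (t : ℂ) :
    Continuous fun c : Fin (D + 1) → Fin n → ℂ => curve c t := by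
  unfold curve
  fun_prop

theorem continuous_curveNorm :
    Continuous (curveNorm : (Fin (D + 1) → Fin n → ℂ) → ℝ) := by
  unfold curveNorm
  fun_prop

/-- A curve which is not contained in a variety meets it for finitely many parameters only. -/
theorem finite_setOf_curve_mem {A : Set (Fin n → ℂ)} (hA : IsAffineVariety A)
    {c : Fin (D + 1) → Fin n → ℂ} {t₀ : ℂ} (ht₀ : curve c t₀ ∉ A) : {t | curve c t ∈ A}.Finite := by
  obtain ⟨a, ha, hat⟩ := hA.exists_eval_ne_zero ht₀
  let P : Polynomial ℂ := MvPolynomial.aeval (curvePoly c) a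
  have hP : ∀ t, P.eval t = MvPolynomial.eval (curve c t) a := fun t => by
    have : (Polynomial.aeval t).comp (MvPolynomial.aeval (curvePoly c)) =
        MvPolynomial.aeval (curve c t) := by
      ext i
      simp [eval_curvePoly]
    rw [← MvPolynomial.aeval_eq_eval]
    exact DFunLike.congr_fun this a
  have hP0 : P ≠ 0 := fun h => hat (by rw [← hP, h, Polynomial.eval_zero])
  refine (Polynomial.finite_setOfPred_isRoot hP0).subset fun t ht => ?_
  exact (hP t).trans (ha _ ht)

theorem range_curve_subset_of_finite {A : Set (Fin n → ℂ)} (hA : IsAffineVariety A)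
    {c : Fin (D + 1) → Fin n → ℂ} (h : {t | curve c t ∉ A}.Finite) : Set.range (curve c) ⊆ A := by
  rintro _ ⟨t₀, rfl⟩
  by_contra ht₀
  refine Set.infinite_univ (α := ℂ) ((h.union (finite_setOf_curve_mem hA ht₀)).subset fun t _ => ?_)
  exact (em (curve c t ∉ A)).imp id not_not.mp

theorem range_curve_subset_or_subset {A B : Set (Fin n → ℂ)} (hA : IsAffineVariety A)
    (hB : IsAffineVariety B) {c : Fin (D + 1) → Fin n → ℂ} (h : Set.range (curve c) ⊆ A ∪ B) :
    Set.range (curve c) ⊆ A ∨ Set.range (curve c) ⊆ B := by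
  refine or_iff_not_imp_left.mpr fun hcA => ?_
  obtain ⟨_, ⟨t₀, rfl⟩, ht₀⟩ := Set.not_subset.mp hcA
  refine range_curve_subset_of_finite hB ((finite_setOf_curve_mem hA ht₀).subset fun t ht => ?_)
  exact (h ⟨t, rfl⟩).resolve_right ht

/-- The reparametrized curve `t ↦ curve c (s t)`. -/
noncomputable def rescale (s : ℂ) (c : Fin (D + 1) → Fin n → ℂ) (j : Fin (D + 1)) : Fin n → ℂ :=
  s ^ (j : ℕ) • c j

theorem rescale_zero (s : ℂ) (c : Fin (D + 1) → Fin n → ℂ) : rescale s c 0 = c 0 := by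
  simp [rescale]

theorem curve_rescale (s : ℂ) (c : Fin (D + 1) → Fin n → ℂ) (t : ℂ) :
    curve (rescale s c) t = curve c (s * t) := by
  simp [curve, rescale, smul_smul, mul_pow, mul_comm]

/-- Every nonconstant curve can be reparametrized to have norm one. -/
theorem exists_curveNorm_rescale_eq_one {c : Fin (D + 1) → Fin n → ℂ} (hc : curveNorm c ≠ 0) :
    ∃ s, curveNorm (rescale s c) = 1 := by
  obtain ⟨j, hj⟩ := exists_ne_zero_of_curveNorm_ne_zero hc
  have hj0 : 0 < ‖c j.succ‖ := norm_pos_iff.mpr hj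
  let f : ℝ → ℝ := fun r => curveNorm (rescale (r : ℂ) c)
  have hf : Continuous f := by
    refine continuous_curveNorm.comp ?_
    unfold rescale
    fun_prop
  have hf0 : f 0 = 0 := by simp [f, curveNorm, rescale]
  let R : ℝ := max 1 ‖c j.succ‖⁻¹
  have hR : 1 ≤ R := le_max_left _ _
  have hfR : 1 ≤ f R := by
    calc (1 : ℝ) = ‖c j.succ‖⁻¹ * ‖c j.succ‖ := (inv_mul_cancel₀ hj0.ne').symm
      _ ≤ R ^ (j.succ : ℕ) * ‖c j.succ‖ := by
          exact mul_le_mul_of_nonneg_right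
            ((le_max_right 1 _).trans (le_self_pow₀ hR (by simp))) hj0.le
      _ = ‖rescale (R : ℂ) c j.succ‖ := by
          rw [rescale, norm_smul, norm_pow, Complex.norm_real, Real.norm_of_nonneg (by linarith)]
      _ ≤ f R := Finset.single_le_sum (f := fun j : Fin D => ‖rescale (R : ℂ) c j.succ‖)
          (fun _ _ => norm_nonneg _) (Finset.mem_univ j)
  obtain ⟨r, -, hr⟩ := intermediate_value_Icc (zero_le_one.trans hR) hf.continuousOn
    (show (1 : ℝ) ∈ Set.Icc (f 0) (f R) from ⟨by rw [hf0]; exact zero_le_one, hfR⟩)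
  exact ⟨r, hr⟩

/-- Curves of norm one through converging points accumulate at a curve of norm one. -/
theorem exists_tendsto_curve {ι : Type*} (l : Ultrafilter ι) {c : ι → Fin (D + 1) → Fin n → ℂ}
    (hc : ∀ k, curveNorm (c k) = 1) {y : Fin n → ℂ} (hy : Tendsto (fun k => c k 0) l (𝓝 y)) :
    ∃ d, Tendsto c l (𝓝 d) ∧ d 0 = y ∧ curveNorm d = 1 := by
  have hbdd : ∀ᶠ k in l, ‖c k‖ ≤ max (‖y‖ + 1) 1 := by
    filter_upwards [hy.norm.eventually_lt_const (lt_add_one ‖y‖)] with k hk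
    refine (pi_norm_le_iff_of_nonneg (by positivity)).mpr fun j => ?_
    cases j using Fin.cases with
    | zero => exact hk.le.trans (le_max_left _ _)
    | succ j =>
      refine le_trans ?_ (le_max_right _ _)
      rw [← hc k]
      exact Finset.single_le_sum (f := fun j : Fin D => ‖c k j.succ‖) (fun _ _ => norm_nonneg _)
        (Finset.mem_univ j)
  obtain ⟨d, hd⟩ := exists_tendsto_of_eventually_norm_le l hbdd
  refine ⟨d, hd, tendsto_nhds_unique (tendsto_pi_nhds.mp hd 0) hy, ?_⟩
  refine tendsto_nhds_unique ((continuous_curveNorm.tendsto d).comp hd) ?_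
  simp only [Function.comp_def, hc, tendsto_const_nhds_iff]

/-- If the base points of a family of curves tend to infinity, so does the whole family, with the
exception of finitely many parameters: these are the zeros of the limit of the curves after
division by the norm of the coefficients. -/
theorem exists_finite_forall_tendsto_norm_curve {ι : Type*} (l : Ultrafilter ι)
    {c : ι → Fin (D + 1) → Fin n → ℂ} (hc : Tendsto (fun k => ‖c k 0‖) l atTop) :
    ∃ T : Set ℂ, T.Finite ∧ ∀ t ∉ T, Tendsto (fun k => ‖curve (c k) t‖) l atTop := by
  have hnorm : Tendsto (fun k => ‖c k‖) l atTop :=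
    tendsto_atTop_mono (fun k => norm_le_pi_norm (c k) 0) hc
  let b : ι → Fin (D + 1) → Fin n → ℂ := fun k => (‖c k‖⁻¹ : ℂ) • c k
  have hb : ∀ᶠ k in l, ‖b k‖ = 1 := by
    filter_upwards [hnorm.eventually_gt_atTop 0] with k hk
    rw [norm_smul, norm_inv, Complex.norm_real, norm_norm, inv_mul_cancel₀ hk.ne']
  obtain ⟨d, hd⟩ := exists_tendsto_of_eventually_norm_le l (hb.mono fun k hk => hk.le)
  have hd1 : ‖d‖ = 1 := tendsto_nhds_unique hd.norm (tendsto_const_nhds.congr' (hb.mono fun k hk =>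
    hk.symm))
  have hd0 : d ≠ 0 := fun h => by simp [h] at hd1
  obtain ⟨j, hj⟩ := Function.ne_iff.mp hd0
  obtain ⟨i, hi⟩ := Function.ne_iff.mp hj
  have hP : curvePoly d i ≠ 0 := fun h => hi (by simp [← coeff_curvePoly d, h])
  refine ⟨{t | (curvePoly d i).IsRoot t}, Polynomial.finite_setOfPred_isRoot hP, fun t ht => ?_⟩
  have hdt : 0 < ‖curve d t‖ := norm_pos_iff.mpr fun h => ht (by
    change Polynomial.eval _ _ = 0
    rw [eval_curvePoly, h]
    rfl)
  have hlim : Tendsto (fun k => ‖curve (b k) t‖) l (𝓝 ‖curve d t‖) :=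
    (((continuous_curve t).tendsto d).comp hd).norm
  refine (hnorm.atTop_mul_pos hdt hlim).congr' ?_
  filter_upwards [hnorm.eventually_gt_atTop 0] with k hk
  have : curve (b k) t = (‖c k‖⁻¹ : ℂ) • curve (c k) t := by
    simp only [curve, b, Pi.smul_apply, Finset.smul_sum]
    exact Finset.sum_congr rfl fun j _ => smul_comm _ _ _
  rw [this, norm_smul, norm_inv, Complex.norm_real, norm_norm, ← mul_assoc,
    mul_inv_cancel₀ hk.ne', one_mul]

end

/-! ### Uniruledness of the non-properness set -/

/-- Through a point of `X \ A` passes a curve in `X` whose image under `F` is a curve of norm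
one. The image is not constant, since the fibres of `F` in `X \ A` are finite. -/
theorem exists_curve_polyMap_eq_curve {n m d₁ d₂ : ℕ} {X A : Set (Fin n → ℂ)}
    (hX : HasUniruledDegreeAtMost d₁ X) {F : Fin m → MvPolynomial (Fin n) ℂ}
    (hdeg : ∀ i, (F i).totalDegree ≤ d₂) (hA : IsAffineVariety A)
    (hfin : ∀ y : Fin m → ℂ, {x | x ∈ X \ A ∧ polyMap F x = y}.Finite) {x : Fin n → ℂ}
    (hx : x ∈ X \ A) :
    ∃ (c : Fin (d₁ + 1) → Fin n → ℂ) (d : Fin (d₁ * d₂ + 1) → Fin m → ℂ), c 0 = x ∧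
      Set.range (curve c) ⊆ X ∧ (∀ t, polyMap F (curve c t) = curve d t) ∧ curveNorm d = 1 := by
  obtain ⟨Z, hZ, hxZ⟩ := exists_isIrreducibleComponent_of_mem hX.1 hx.1
  obtain ⟨Γ, hΓ, hΓZ, hxΓ⟩ := hX.2 Z hZ x hxZ
  obtain ⟨c, hc0, hc, rfl⟩ := hΓ.exists_curve hxΓ
  have hcX : Set.range (curve c) ⊆ X := hΓZ.trans hZ.1.2
  let φ : Fin m → Polynomial ℂ := fun i => MvPolynomial.aeval (curvePoly c) (F i)
  have hφdeg : ∀ i, (φ i).natDegree ≤ d₁ * d₂ := fun i => by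
    rw [mul_comm]
    exact MvPolynomial.aeval_natDegree_le _ (hdeg i) _ (natDegree_curvePoly_le c)
  have hφ : ∀ t, (fun i => (φ i).eval t) = polyMap F (curve c t) := fun t => by
    ext i
    have : (Polynomial.aeval t).comp (MvPolynomial.aeval (curvePoly c)) =
        MvPolynomial.aeval (curve c t) := by
      ext i
      simp [eval_curvePoly]
    rw [polyMap, ← MvPolynomial.aeval_eq_eval]
    exact DFunLike.congr_fun this (F i)
  let d : Fin (d₁ * d₂ + 1) → Fin m → ℂ := fun j i => (φ i).coeff j
  have hd : ∀ t, polyMap F (curve c t) = curve d t := fun t => by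
    rw [← hφ, curve_coeff hφdeg]
  have hdnorm : curveNorm d ≠ 0 := fun h0 => by
    have hconst := curve_eq_of_curveNorm_eq_zero h0
    obtain ⟨j, hj⟩ := exists_ne_zero_of_curveNorm_ne_zero hc
    obtain ⟨i, hi⟩ := Function.ne_iff.mp hj
    -- the `i`-th coordinate is not constant along the curve, so it attains a value finitely often
    have hfib : ∀ z, {t | curve c t i = z}.Finite := fun z => by
      have hP : curvePoly c i - Polynomial.C z ≠ 0 := fun h => hi (by
        have := congrArg (fun P => P.coeff j.succ) h
        simpa [coeff_curvePoly, Polynomial.coeff_C, -Fin.val_succ] using this)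
      refine (Polynomial.finite_setOfPred_isRoot hP).subset fun t ht => ?_
      change Polynomial.eval _ _ = 0
      rw [Polynomial.eval_sub, Polynomial.eval_C, eval_curvePoly]
      exact sub_eq_zero.mpr ht
    have hxc : curve c 0 ∉ A := by
      rw [curve_zero, hc0]
      exact hx.2
    have hgood : {t | curve c t ∉ A}.Finite := by
      refine (Set.Finite.biUnion (hfin (d 0)) fun z _ => hfib (z i)).subset fun t ht => ?_
      exact Set.mem_biUnion (x := curve c t)
        ⟨⟨hcX ⟨t, rfl⟩, ht⟩, (hd t).trans (hconst t)⟩ rfl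
    refine Set.infinite_univ (α := ℂ)
      ((hgood.union (finite_setOf_curve_mem hA hxc)).subset fun t _ => ?_)
    exact (em (curve c t ∉ A)).imp id not_not.mp
  obtain ⟨s, hs⟩ := exists_curveNorm_rescale_eq_one hdnorm
  refine ⟨rescale s c, rescale s d, by rw [rescale_zero, hc0], ?_, fun t => ?_, hs⟩
  · rintro _ ⟨t, rfl⟩
    rw [curve_rescale]
    exact hcX ⟨_, rfl⟩
  · rw [curve_rescale, curve_rescale, hd]

/-- Through every point `y` of the non-properness set passes a curve in it: a limit of the images
of curves in `X` through points tending to infinity. -/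
theorem exists_curve_subset_nonProperSet {n m d₁ d₂ : ℕ} {X : Set (Fin n → ℂ)}
    (hX : HasUniruledDegreeAtMost d₁ X) {F : Fin m → MvPolynomial (Fin n) ℂ}
    (hdeg : ∀ i, (F i).totalDegree ≤ d₂) (hfin : GenericallyFiniteOn F X) {y : Fin m → ℂ}
    (hy : y ∈ nonProperSet F X) :
    ∃ d : Fin (d₁ * d₂ + 1) → Fin m → ℂ,
      d 0 = y ∧ curveNorm d = 1 ∧ Set.range (curve d) ⊆ nonProperSet F X := by
  obtain ⟨A, hA, hdense, hfib⟩ := hfin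
  obtain ⟨ι, l, x, hx, hxy, hinf⟩ := exists_tendsto_of_mem_nonProperSet F hX.1 hA hdense hy
  choose c d hc0 hcX hcd hd using fun k => exists_curve_polyMap_eq_curve hX hdeg hA hfib (hx k)
  have hd0 : ∀ k, d k 0 = polyMap F (x k) := fun k => by
    rw [← curve_zero (d k), ← hcd, curve_zero, hc0]
  obtain ⟨e, he, he0, he1⟩ := exists_tendsto_curve l hd (by simpa only [hd0] using hxy)
  obtain ⟨T, hT, hTinf⟩ := exists_finite_forall_tendsto_norm_curve l
    (c := c) (by simpa only [hc0] using hinf)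
  refine ⟨e, he0, he1, range_curve_subset_of_finite (isAffineVariety_nonProperSet F X)
    (hT.subset fun t ht => ?_)⟩
  by_contra htT
  refine ht (mem_nonProperSet_of_tendsto F X (l := (l : Filter ι)) (x := fun k => curve (c k) t)
    (fun k => hcX k ⟨t, rfl⟩) ?_ (hTinf t htT))
  simp only [hcd]
  exact ((continuous_curve t).tendsto e).comp he

/-- It suffices to find curves inside `V`, not inside the components of `V`: at a point lying on
only one component `Z` the curve is contained in `Z`, and such points are dense in `Z`. -/
theorem hasUniruledDegreeAtMost_of_forall_exists_curve {n D : ℕ} {V : Set (Fin n → ℂ)}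
    (hV : IsAffineVariety V) (h : ∀ y ∈ V, ∃ d : Fin (D + 1) → Fin n → ℂ,
      d 0 = y ∧ curveNorm d = 1 ∧ Set.range (curve d) ⊆ V) : HasUniruledDegreeAtMost D V := by
  refine ⟨hV, fun Z hZ y hy => ?_⟩
  have hZaff : IsAffineVariety Z := hZ.1.1.1
  obtain ⟨W, hW, hVW, hZW⟩ := hZ.exists_subset_union hV
  have hcurve : ∀ z : (Z \ W : Set (Fin n → ℂ)), ∃ d : Fin (D + 1) → Fin n → ℂ,
      d 0 = z ∧ curveNorm d = 1 ∧ Set.range (curve d) ⊆ Z := fun z => by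
    obtain ⟨d, hd0, hd1, hdV⟩ := h z (hZ.1.2 z.2.1)
    refine ⟨d, hd0, hd1, (range_curve_subset_or_subset hZaff hW (hdV.trans hVW)).resolve_right ?_⟩
    intro hdW
    refine z.2.2 (hdW ⟨0, ?_⟩)
    rw [curve_zero, hd0]
  choose d hd0 hd1 hdZ using hcurve
  have hne : (comap ((↑) : (Z \ W : Set (Fin n → ℂ)) → Fin n → ℂ) (𝓝 y)).NeBot :=
    mem_closure_iff_comap_neBot.mp (hZ.1.1.subset_closure_diff hW hZW hy)
  let l := Ultrafilter.of (comap ((↑) : (Z \ W : Set (Fin n → ℂ)) → Fin n → ℂ) (𝓝 y))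
  have hl : Tendsto ((↑) : (Z \ W : Set (Fin n → ℂ)) → Fin n → ℂ) l (𝓝 y) :=
    tendsto_comap.mono_left (Ultrafilter.of_le _)
  obtain ⟨e, he, he0, he1⟩ := exists_tendsto_curve l hd1 (by simpa only [hd0] using hl)
  refine ⟨Set.range (curve e), isParametricCurve_range_curve (by rw [he1]; exact one_ne_zero), ?_,
    ⟨0, by rw [curve_zero, he0]⟩⟩
  rintro _ ⟨t, rfl⟩
  exact hZaff.isClosed.mem_of_tendsto (((continuous_curve t).tendsto e).comp he)
    (Eventually.of_forall fun z => hdZ z ⟨t, rfl⟩)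

end AffineUniruled

theorem mainTheorem2 {n m : ℕ} (d₁ d₂ : ℕ) (X : Set (Fin n → ℂ))
    (hX : AffineUniruled.HasUniruledDegreeAtMost d₁ X)
    (F : Fin m → MvPolynomial (Fin n) ℂ)
    (hdeg : ∀ i, (F i).totalDegree ≤ d₂)
    (hfin : AffineUniruled.GenericallyFiniteOn F X) :
    AffineUniruled.nonProperSet F X = ∅ ∨
      AffineUniruled.HasUniruledDegreeAtMost (d₁ * d₂) (AffineUniruled.nonProperSet F X) :=
  Or.inr (AffineUniruled.hasUniruledDegreeAtMost_of_forall_exists_curve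
    (AffineUniruled.isAffineVariety_nonProperSet F X) fun _ hy =>
      AffineUniruled.exists_curve_subset_nonProperSet hX hdeg hfin hy)
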